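/- All varieties are complex algebraic varieties. An arrangement of subvarieties of a nonsingular variety $X$ is a finite set $\Lambda$ of nonsingular closed connected (nonempty) subvarieties properly contained in $X$ such that any two members $A,B$ intersect cleanly (i.e. $A\cap B$ is nonsingular and $T_{A\cap B,y}=T_{A,y}\cap T_{B,y}$ for all $y\in A\cap B$) and $A\cap B$ is either empty or a disjoint union of members of $\Lambda$; it is simple if moreover every nonempty $A\cap B$ belongs to $\Lambda$. A subset $\mathcal G\subseteq\Lambda$ of a simple arrangement is a building set for $\Lambda$ if for every $L\in\Lambda\setminus\mathcal G$ the minimal elements of $\{G\in\mathcal G: G\supseteq L\}$ intersect transversally and their intersection is $L$. A subset $\mathcal G\subseteq \Lambda$ of an arbitrary arrangement is a building set for $\Lambda$ if $X$ has a (Zariski) open cover $\{U_i\}$ such that, for each $i$, the restriction $\Lambda_{|U_i}$ (the family of nonempty intersections $A\cap U_i$, $A\in\Lambda$) is a simple arrangement of $U_i$ and $\mathcal G_{|U_i}$ is a building set for it. A finite set $\mathcal G$ of closed connected subvarieties of $X$ is a building set in $X$ if the set of connected components of all intersections of nonempty collections of members of $\mathcal G$ is an arrangement $\Lambda$ of subvarieties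 of $X$ and $\mathcal G$ is a building set for $\Lambda$. It is well connected if, for every nonempty subset of $\mathcal G$, the intersection of its members is empty, or connected, or all its connected components belong to $\mathcal G$. Let $X$ be a nonsingular variety and let $\mathcal G=\{G_1,\dots,G_m\}$, $m\ge 1$, be a well connected building set in $X$, whose members are distinct and numbered so that $G_i\subsetneq G_j$ implies $i<j$. Put $Z=G_m$ and let $\mathcal H$ be the set of all connected components of the intersections $G_i\cap Z$ with $i<m$. Then: 1. $\mathcal H$ is a well connected building set in $Z$. 2. Every $H\in\mathcal H$ equals $G_k\cap Z$ for some $k<m$. Write $\mathcal H=\{H_1,\dots,H_u\}$, ordered so that $s_1<s_2<\dots<s_u$, where $s_i\le m-1$ is the minimal index with $H_i=G_{s_i}\cap Z$. Then for each $1\le i\le u$ the set $\mathcal H_i=\{H_1,\dots,H_i\}$ is a well connected building set in $Z$. -/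

import Mathlib

open AlgebraicGeometry CategoryTheory TopologicalSpace IsLocalRing

namespace SubvarietyArrangement

noncomputable section

/- Points of a complex variety are the closed points of the corresponding scheme. For an open subset
of a scheme of finite type over a field, the closed points of the open subset are the closed points
of the scheme that lie in it. -/

/-- A (locally Noetherian) scheme is nonsingular if its local rings at closed points are regular. -/
def IsNonsingular (X : Scheme) : Prop :=
  ∀ y : X, IsClosed ({y} : Set X) → IsRegularLocalRing (X.presheaf.stalk y)

/-- `VanishesOn A V s`: the regular function `s` on `V` has value `0` (in the residue field) at all
points of `A ∩ V`. -/
def VanishesOn {X : Scheme} (A : Set X) (V : X.Opens) (s : Γ(X, V)) : Prop :=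
  ∀ (x : X) (hx : x ∈ V), x ∈ A → X.evaluation V x hx s = 0

theorem VanishesOn.res {X : Scheme} {A : Set X} {V W : X.Opens} {s : Γ(X, V)}
    (h : VanishesOn A V s) (i : W ⟶ V) : VanishesOn A W (X.presheaf.map i.op s) := by
  intro x hx hA
  rw [Scheme.evaluation_eq_zero_iff_notMem_basicOpen, Scheme.basicOpen_res]
  intro hmem
  have h0 := h x (i.le hx) hA
  rw [Scheme.evaluation_eq_zero_iff_notMem_basicOpen] at h0
  exact h0 hmem.2

/-- The ideal `I_{A,y}` of the germs at `y` of regular functions vanishing on `A` near `y`. -/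
def idealAt {X : Scheme} (A : Set X) (y : X) : Ideal (X.presheaf.stalk y) where
  carrier := {f | ∃ (V : X.Opens) (hy : y ∈ V) (s : Γ(X, V)),
    VanishesOn A V s ∧ X.presheaf.germ V y hy s = f}
  zero_mem' := ⟨⊤, trivial, 0, fun x hx _ => map_zero _, map_zero _⟩
  add_mem' := by
    rintro _ _ ⟨V, hV, s, hs, rfl⟩ ⟨W, hW, t, ht, rfl⟩
    have hVW : y ∈ V ⊓ W := ⟨hV, hW⟩
    refine ⟨V ⊓ W, hVW, X.presheaf.map (homOfLE inf_le_left).op s +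
      X.presheaf.map (homOfLE inf_le_right).op t, ?_, ?_⟩
    · intro x hx hA
      rw [map_add, hs.res (homOfLE inf_le_left) x hx hA, ht.res (homOfLE inf_le_right) x hx hA,
        add_zero]
    · rw [map_add, TopCat.Presheaf.germ_res_apply, TopCat.Presheaf.germ_res_apply]
  smul_mem' := by
    rintro c _ ⟨W, hW, t, ht, rfl⟩
    obtain ⟨V, hV, s, rfl⟩ := X.presheaf.exists_germ_eq c
    have hVW : y ∈ V ⊓ W := ⟨hV, hW⟩
    refine ⟨V ⊓ W, hVW, X.presheaf.map (homOfLE inf_le_left).op s *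
      X.presheaf.map (homOfLE inf_le_right).op t, ?_, ?_⟩
    · intro x hx hA
      rw [map_mul, ht.res (homOfLE inf_le_right) x hx hA, mul_zero]
    · rw [map_mul, TopCat.Presheaf.germ_res_apply, TopCat.Presheaf.germ_res_apply, smul_eq_mul]

/-- A locally closed subset with its reduced structure (whose local ring at `y` is
`𝒪_{X,y} / I_{A,y}`) is nonsingular. -/
def IsNonsingularSubset {X : Scheme} (A : Set X) : Prop :=
  ∀ y ∈ A, IsClosed ({y} : Set X) → IsRegularLocalRing (X.presheaf.stalk y ⧸ idealAt A y)

/-- The cotangent space `𝔪_y / 𝔪_y²` of `X` at `y`, over the residue field of the local ring. -/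
abbrev Cotangent (X : Scheme) (y : X) : Type _ := CotangentSpace (X.presheaf.stalk y)

/-- The (Zariski) tangent space of `X` at `y`, the dual of `𝔪_y / 𝔪_y²`. -/
abbrev Tangent (X : Scheme) (y : X) : Type _ :=
  Module.Dual (ResidueField (X.presheaf.stalk y)) (Cotangent X y)

/-- The classes in `𝔪_y / 𝔪_y²` of the germs vanishing on `A`: the differentials at `y` of
the local equations of `A`. -/
def differentialsAt {X : Scheme} (A : Set X) (y : X) : Set (Cotangent X y) :=
  {c | ∃ f : maximalIdeal (X.presheaf.stalk y),
    (f : X.presheaf.stalk y) ∈ idealAt A y ∧ (maximalIdeal (X.presheaf.stalk y)).toCotangent f = c}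

/-- The tangent space `T_{A,y}` as a subspace of `T_{X,y}`: the tangent vectors annihilated by
the differentials of all functions vanishing on `A`. -/
def tangentAt {X : Scheme} (A : Set X) (y : X) :
    Submodule (ResidueField (X.presheaf.stalk y)) (Tangent X y) :=
  (Submodule.span (ResidueField (X.presheaf.stalk y)) (differentialsAt A y)).dualAnnihilator

/-- `A` and `B` intersect cleanly. -/
def IntersectCleanly {X : Scheme} (A B : Set X) : Prop :=
  IsNonsingularSubset (A ∩ B) ∧
    ∀ y ∈ A ∩ B, IsClosed ({y} : Set X) → tangentAt (A ∩ B) y = tangentAt A y ⊓ tangentAt B y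

/-- The members of `S` intersect transversally: at each point `y` of their common intersection, the
annihilators of their tangent spaces in the cotangent space at `y` form a direct sum (that is, the
codimensions of the tangent spaces add up). -/
def IntersectTransversally {X : Scheme} (S : Set (Set X)) : Prop :=
  ∀ y ∈ ⋂₀ S, IsClosed ({y} : Set X) →
    iSupIndep (fun A : S => (tangentAt (A : Set X) y).dualCoannihilator)

/-- `A` is a nonsingular closed connected (in particular nonempty) subvariety of the open set `U`,
properly contained in `U`. -/
structure IsProperSubvariety {X : Scheme} (U : X.Opens) (A : Set X) : Prop where
  closed : ∃ C : Set X, IsClosed C ∧ A = C ∩ U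
  connected : _root_.IsConnected A
  nonsingular : IsNonsingularSubset A
  proper : A ⊂ (U : Set X)

/-- `Λ` is a simple arrangement of subvarieties of the variety `U`. -/
structure IsSimpleArrangement {X : Scheme} (U : X.Opens) (Λ : Set (Set X)) : Prop where
  finite : Λ.Finite
  subvariety : ∀ A ∈ Λ, IsProperSubvariety U A
  clean : ∀ A ∈ Λ, ∀ B ∈ Λ, IntersectCleanly A B
  inter : ∀ A ∈ Λ, ∀ B ∈ Λ, A ∩ B ∈ Λ ∨ A ∩ B = ∅

/-- The minimal elements of `{G ∈ 𝒢 | L ⊆ G}`. -/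
def factors {X : Scheme} (𝒢 : Set (Set X)) (L : Set X) : Set (Set X) :=
  {G | Minimal (fun K => K ∈ 𝒢 ∧ L ⊆ K) G}

/-- `𝒢` is a building set for the simple arrangement `Λ`. -/
structure IsSimpleBuildingSetFor {X : Scheme} (Λ 𝒢 : Set (Set X)) : Prop where
  subset : 𝒢 ⊆ Λ
  transversal : ∀ L ∈ Λ \ 𝒢, IntersectTransversally (factors 𝒢 L)
  inter : ∀ L ∈ Λ \ 𝒢, ⋂₀ factors 𝒢 L = L

/-- `Λ` is an arrangement of subvarieties of `X`. (In the last condition the disjoint union is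
empty exactly when `A ∩ B` is empty.) -/
structure IsArrangement {X : Scheme} (Λ : Set (Set X)) : Prop where
  finite : Λ.Finite
  subvariety : ∀ A ∈ Λ, IsProperSubvariety ⊤ A
  clean : ∀ A ∈ Λ, ∀ B ∈ Λ, IntersectCleanly A B
  inter : ∀ A ∈ Λ, ∀ B ∈ Λ, ∃ S ⊆ Λ, S.PairwiseDisjoint id ∧ A ∩ B = ⋃₀ S

/-- The restriction of a family to an open set: the nonempty intersections of its members with
`U`. -/
def restrict {X : Scheme} (Λ : Set (Set X)) (U : X.Opens) : Set (Set X) :=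
  {A | A.Nonempty ∧ ∃ B ∈ Λ, A = B ∩ U}

/-- `𝒢` is a building set for the arrangement `Λ`: it is one for a simple arrangement on
each member of some open cover. -/
structure IsBuildingSetFor {X : Scheme} (Λ 𝒢 : Set (Set X)) : Prop where
  subset : 𝒢 ⊆ Λ
  cover : ∃ 𝒰 : Set X.Opens, sSup 𝒰 = ⊤ ∧ ∀ U ∈ 𝒰,
    IsSimpleArrangement U (restrict Λ U) ∧
      IsSimpleBuildingSetFor (restrict Λ U) (restrict 𝒢 U)

/-- The set of connected components of a subset of a space (with the subspace topology). -/
def components {T : Type*} [TopologicalSpace T] (A : Set T) : Set (Set T) :=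
  {C | ∃ x ∈ A, C = connectedComponentIn A x}

/-- The connected components of all intersections of (nonempty) collections from `𝒢`. -/
def inducedArrangement {X : Scheme} (𝒢 : Set (Set X)) : Set (Set X) :=
  {C | ∃ S ⊆ 𝒢, S.Nonempty ∧ C ∈ components (⋂₀ S)}

/-- `𝒢` is a building set in `X`. -/
structure IsBuildingSet {X : Scheme} (𝒢 : Set (Set X)) : Prop where
  finite : 𝒢.Finite
  closed : ∀ A ∈ 𝒢, IsClosed A
  connected : ∀ A ∈ 𝒢, _root_.IsConnected A
  arrangement : IsArrangement (inducedArrangement 𝒢)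
  building : IsBuildingSetFor (inducedArrangement 𝒢) 𝒢

/-- `𝒢` is a well connected building set in `X`. -/
structure IsWellConnectedBuildingSet {X : Scheme} (𝒢 : Set (Set X)) : Prop where
  isBuildingSet : IsBuildingSet 𝒢
  wellConnected : ∀ S ⊆ 𝒢, S.Nonempty →
    ⋂₀ S = ∅ ∨ _root_.IsConnected (⋂₀ S) ∨ components (⋂₀ S) ⊆ 𝒢

/-- A closed subset as a variety: the reduced induced closed subscheme. -/
def asVariety {X : Scheme} (Z : Closeds X) : Scheme :=
  (Scheme.IdealSheafData.vanishingIdeal Z).subscheme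

/-- The inclusion of a closed subvariety. -/
def inclusion {X : Scheme} (Z : Closeds X) : asVariety Z ⟶ X :=
  (Scheme.IdealSheafData.vanishingIdeal Z).subschemeι

/-- The intersection `A ∩ Z` as a subset of the variety `Z`. -/
def trace {X : Scheme} (Z : Closeds X) (A : Set X) : Set (asVariety Z) :=
  (inclusion Z) ⁻¹' A

/-- For `G 0, …, G n` with last member `Z = G n`: the family of the connected
components, in the variety `Z`, of the intersections `G i ∩ Z` with `i < n`. -/
def tracedFamily {X : Scheme} {n : ℕ} (G : Fin (n + 1) → Closeds X) :
    Set (Set (asVariety (G (Fin.last n)))) :=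
  {H | ∃ i : Fin n, H ∈ components (trace (G (Fin.last n)) (G i.castSucc : Set X))}

end

end SubvarietyArrangement

/-!
# Traces of a well connected building set on a maximal member

Let `𝒢` be a well connected building set and `Z ∈ 𝒢` a member that is maximal for inclusion; the
last member of a family numbered compatibly with inclusion is such a `Z`.

*Irreducibility.* A regular local ring is a domain (`IsRegularLocalRing.isDomain`), so a nonsingular
connected closed subset of a Noetherian Jacobson scheme is irreducible
(`IsNonsingularSubset.isIrreducible`). Hence an inclusion between members of `𝒢` can be tested on
any open set which the smaller one meets. The local part of the definition of a building set is
stated in `IsBuildingSetOn` through the intersections of members over the sets of an open cover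
(`IsBuildingSet.exists_cover`, `IsBuildingSet.of_cover`).

*Ideals instead of tangent spaces.* Subspaces of `𝔪 / 𝔪²` are ideals between `𝔪²` and `𝔪`. Thus
`A` and `B` meet cleanly at `y` when `I_{A ∩ B} + 𝔪² = I_A + I_B + 𝔪²` (and `A ∩ B` is
nonsingular), and members of a family meet transversally at `y` when their ideals are independent
modulo `𝔪²` (`iSupIndep_dualCoannihilator_tangentAt_iff`). Restriction to `Z` is passage to
`𝒪_{X,y} / I_Z`. If `a_i` are ideals independent modulo `𝔪²` and `I_Z` is contained in one of them,
then the `a_i + I_Z` are independent modulo `𝔪² + I_Z`; this is a consequence of the modular law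
(`inf_sup_le_of_independent`) and gives the transversality of the traces.

*Traces.* If `A ∩ Z` is disconnected, its components belong to `𝒢` by well connectedness, so every
component of `A ∩ Z` is itself of the form `K ∩ Z` with `K ∈ 𝒢` (`eq_trace_of_mem_traces`). Every
intersection of traces is then an intersection of members of `𝒢`, and over an open set of the cover
the factors of such an intersection `L` in the traced family are traces of factors of `L` in `𝒢`
(`exists_factor_image_eq`). This shows that the traced family is a well connected building set
(`isWellConnectedBuildingSet_traces`).

*Initial segments.* A subfamily that is closed downwards under inclusion is again a well connected
building set: its factors of an intersection of its members are also factors in the whole family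
(`IsWellConnectedBuildingSet.mono`). It remains to see that `H_a ⊆ H_b` implies `s_a ≤ s_b`. Put
`A = G_{s_a}` and `B = G_{s_b}`, so that `A ∩ Z ⊆ B`. By `subset_or_exists_ssubset_of_inter_subset`
either `A ⊆ B`, and then `s_a ≤ s_b`, or some `K ⊂ A` in `𝒢` has the same trace as `A`, which
contradicts the minimality of `s_a`. The reason for this dichotomy: if neither holds, then `A` is
locally a factor of `A ∩ Z`, and `B` contains a factor other than `A`. Independence, reduced modulo
`I_Z`, forces `I_B ⊆ I_Z + 𝔪²`, so that `B ∩ Z` and `Z` have the same tangent space at a point.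
Both are nonsingular, so they agree near that point, whence `Z ⊆ B`, against the maximality of `Z`.
-/

universe u

namespace SubvarietyArrangement

/-! ### Regular local rings -/

/-- Dividing by an element of `𝔪 \ 𝔪²` lowers the embedding dimension: the element is part of a
minimal system of generators. -/
theorem spanFinrank_maximalIdeal_quotient_lt {R : Type*} [CommRing R] [IsLocalRing R]
    [IsNoetherianRing R] {x : R} (hx : x ∈ maximalIdeal R) (hx2 : x ∉ maximalIdeal R ^ 2) :
    ((maximalIdeal R).map (Ideal.Quotient.mk (Ideal.span {x}))).spanFinrank <
      (maximalIdeal R).spanFinrank := by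
  classical
  have hfg : (maximalIdeal R).FG := (maximalIdeal R).fg_of_isNoetherianRing
  have hfin := Submodule.FG.finite_generators hfg
  set S : Finset R := hfin.toFinset with hS
  have hSspan : Ideal.span (S : Set R) = maximalIdeal R := by
    simpa [hS, Ideal.span] using (maximalIdeal R).span_generators
  have hScard : S.card = (maximalIdeal R).spanFinrank := by
    rw [← Submodule.FG.generators_ncard hfg, Set.ncard_eq_toFinset_card _ hfin]
  obtain ⟨a, -, ha⟩ := Submodule.mem_span_finset.mp
    (show x ∈ Ideal.span (S : Set R) by rwa [hSspan])
  -- As `x ∉ 𝔪²`, some minimal generator `s` has a unit coefficient in `x`, so it can be dropped in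
  -- the quotient.
  obtain ⟨s, hs, has⟩ : ∃ s ∈ S, IsUnit (a s) := by
    by_contra! h
    refine hx2 (ha ▸ Ideal.sum_mem _ fun s hs => ?_)
    rw [pow_two, smul_eq_mul]
    exact Ideal.mul_mem_mul ((mem_maximalIdeal _).2 (h s hs))
      (hSspan ▸ Ideal.subset_span (Finset.mem_coe.2 hs))
  set f := Ideal.Quotient.mk (Ideal.span {x}) with hf
  have hfx : f x = 0 := Ideal.Quotient.eq_zero_iff_mem.2 (Ideal.mem_span_singleton_self x)
  have hmap : (maximalIdeal R).map f = Ideal.span (f '' (S.erase s : Set R)) := by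
    rw [← hSspan, Ideal.map_span]
    refine le_antisymm (Ideal.span_le.2 ?_) (Ideal.span_mono (Set.image_mono ?_))
    · rintro _ ⟨t, ht, rfl⟩
      by_cases hts : t = s
      · subst hts
        have h0 : f (a t) * f t = - ∑ u ∈ S.erase t, f (a u) * f u := by
          rw [← Finset.add_sum_erase _ _ hs] at ha
          have := congrArg f ha
          simp only [smul_eq_mul, map_add, map_mul, map_sum, hfx] at this
          exact eq_neg_of_add_eq_zero_left this
        have h1 : f (a t) * f t ∈ Ideal.span (f '' (S.erase t : Set R)) := by
          rw [h0]
          exact neg_mem (Ideal.sum_mem _ fun u hu => Ideal.mul_mem_left _ _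
            (Ideal.subset_span ⟨u, Finset.mem_coe.2 hu, rfl⟩))
        exact (Ideal.unit_mul_mem_iff_mem _ (has.map f)).1 h1
      · exact Ideal.subset_span ⟨t, Finset.mem_coe.2 (Finset.mem_erase.2 ⟨hts, ht⟩), rfl⟩
    · exact_mod_cast Finset.erase_subset _ _
  rw [hmap, ← hScard]
  calc _ ≤ (f '' (S.erase s : Set R)).ncard :=
        Submodule.spanFinrank_span_le_ncard_of_finite ((Finset.finite_toSet _).image _)
    _ ≤ (S.erase s : Set R).ncard := Set.ncard_image_le (Finset.finite_toSet _)
    _ < S.card := by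
        rw [Set.ncard_coe_finset]; exact Finset.card_erase_lt_of_mem hs

/-- Induction on the embedding dimension `d`. By prime avoidance there is `x ∈ 𝔪` outside `𝔪²` and
outside the minimal primes; then `R / (x)` is regular of dimension `d - 1`, hence a domain, and a
minimal prime contained in `(x)` vanishes by Nakayama's lemma. -/
theorem _root_.IsRegularLocalRing.isDomain_of_spanFinrank_eq (d : ℕ) : ∀ (R : Type u) [CommRing R]
    [IsRegularLocalRing R], (maximalIdeal R).spanFinrank = d → IsDomain R := by
  induction d with
  | zero =>
    intro R _ _ hd
    have h0 : maximalIdeal R = ⊥ := (Submodule.spanFinrank_eq_zero_iff_eq_bot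
      (maximalIdeal R).fg_of_isNoetherianRing).1 hd
    exact (isField_iff_maximalIdeal_eq.2 h0).isDomain
  | succ d ih =>
    intro R _ _ hd
    have hdim : ringKrullDim R = (d + 1 : ℕ) := by
      rw [← IsRegularLocalRing.spanFinrank_maximalIdeal, hd]
    -- Otherwise `𝔪 = 0` by Nakayama's lemma, although `d + 1 > 0`.
    have hm2 : ¬ maximalIdeal R ≤ maximalIdeal R ^ 2 := by
      intro h
      have : maximalIdeal R = ⊥ := Submodule.eq_bot_of_le_smul_of_le_jacobson_bot
        (maximalIdeal R) (maximalIdeal R) (maximalIdeal R).fg_of_isNoetherianRing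
        (by rwa [smul_eq_mul, ← pow_two]) (maximalIdeal_le_jacobson _)
      rw [this] at hd
      simp at hd
    -- Otherwise `𝔪` has height `0`, although `R` has dimension `d + 1`.
    have hmin : ∀ p ∈ minimalPrimes R, ¬ maximalIdeal R ≤ p := by
      intro p hp h
      have hpp := hp.1.1
      have hpm : p = maximalIdeal R := le_antisymm (le_maximalIdeal hpp.ne_top) h
      have h0 := IsLocalRing.maximalIdeal_height_eq_ringKrullDim (R := R)
      rw [hdim, Ideal.height_eq_zero_iff.2 (hpm ▸ hp)] at h0
      norm_cast at h0
    obtain ⟨x, hx, hxn⟩ : ∃ x ∈ maximalIdeal R, x ∉ maximalIdeal R ^ 2 ∧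
        ∀ p ∈ minimalPrimes R, x ∉ p := by
      by_contra! h
      have := (Ideal.subset_union_prime_finite (s := insert (maximalIdeal R ^ 2) (minimalPrimes R))
        ((minimalPrimes.finite_of_isNoetherianRing R).insert _) (f := id)
        (maximalIdeal R ^ 2) (maximalIdeal R ^ 2) (I := maximalIdeal R) ?_).1 ?_
      · obtain ⟨p, rfl | hp, h⟩ := this
        exacts [hm2 h, hmin p hp h]
      · rintro p (rfl | hp) h1 -
        exacts [absurd rfl h1, hp.1.1]
      · intro x hx
        by_cases hx2 : x ∈ maximalIdeal R ^ 2
        · exact Set.mem_biUnion (Set.mem_insert _ _) hx2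
        · obtain ⟨p, hp, hxp⟩ := h x hx hx2
          exact Set.mem_biUnion (Set.mem_insert_of_mem _ hp) hxp
    obtain ⟨hx2, hxp⟩ := hxn
    have : Nontrivial (R ⧸ Ideal.span {x}) := Ideal.Quotient.nontrivial_iff.2
      (fun h => (maximalIdeal.isMaximal R).ne_top
        (top_le_iff.1 (h ▸ (by simpa [Ideal.span_le] using hx))))
    have : IsLocalRing (R ⧸ Ideal.span {x}) := .of_surjective' _ Ideal.Quotient.mk_surjective
    have hmm : (maximalIdeal R).map (Ideal.Quotient.mk (Ideal.span {x})) =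
        maximalIdeal (R ⧸ Ideal.span {x}) :=
      map_maximalIdeal_of_surjective _ Ideal.Quotient.mk_surjective
    -- Dividing by one element lowers the dimension by at most `1`.
    have hle : (d : WithBot ℕ∞) ≤ ringKrullDim (R ⧸ Ideal.span {x}) := by
      have := ringKrullDim_le_ringKrullDim_quotient_add_card (R := R) {x} (by
        rw [IsLocalRing.ringJacobson_eq_maximalIdeal]; simpa using hx)
      rw [hdim, Finset.coe_singleton, Finset.card_singleton] at this
      push_cast at this
      exact ENat.WithBot.add_le_add_one_right_iff.1 this
    have hlt := spanFinrank_maximalIdeal_quotient_lt hx hx2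
    rw [hmm, hd] at hlt
    have hreg : IsRegularLocalRing (R ⧸ Ideal.span {x}) := .of_spanFinrank_maximalIdeal_le _
      (le_trans (by exact_mod_cast Nat.lt_succ_iff.1 hlt) hle)
    have hdom := ih (R ⧸ Ideal.span {x}) (by
      have := ringKrullDim_le_spanFinrank_maximalIdeal (R ⧸ Ideal.span {x})
      have := hle.trans this
      have : d ≤ (maximalIdeal (R ⧸ Ideal.span {x})).spanFinrank := by exact_mod_cast this
      omega)
    have hxprime : (Ideal.span {x}).IsPrime := (Ideal.Quotient.isDomain_iff_prime _).1 hdom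
    obtain ⟨p, hp, hpx⟩ := Ideal.exists_minimalPrimes_le (I := ⊥) (J := Ideal.span {x}) bot_le
    have hpp := hp.1.1
    -- Since `p ⊆ (x)` and `x ∉ p`, every element of `p` is `a * x` with `a ∈ p`, so `p = (x) p`.
    have hp0 : p = ⊥ := by
      refine Submodule.eq_bot_of_le_smul_of_le_jacobson_bot (Ideal.span {x}) p
        p.fg_of_isNoetherianRing (fun y hy => ?_) ?_
      · obtain ⟨a, rfl⟩ := Ideal.mem_span_singleton'.1 (hpx hy)
        have := (hpp.mem_or_mem hy).resolve_right (hxp p hp)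
        rw [smul_eq_mul, mul_comm a]
        exact Ideal.mul_mem_mul (Ideal.mem_span_singleton_self x) this
      · exact le_trans (by simpa [Ideal.span_le] using hx) (maximalIdeal_le_jacobson _)
    subst hp0
    exact IsDomain.of_bot_isPrime R

theorem _root_.IsRegularLocalRing.isDomain (R : Type u) [CommRing R] [IsRegularLocalRing R] :
    IsDomain R :=
  IsRegularLocalRing.isDomain_of_spanFinrank_eq _ R rfl

/-- Dividing by an ideal contained in `𝔪²` does not lower the embedding dimension. -/
theorem spanFinrank_le_quotient {R : Type*} [CommRing R] [IsLocalRing R] [IsNoetherianRing R]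
    {J : Ideal R} (hJ : J ≤ maximalIdeal R ^ 2) [IsLocalRing (R ⧸ J)] :
    (maximalIdeal R).spanFinrank ≤ (maximalIdeal (R ⧸ J)).spanFinrank := by
  have hfg : (maximalIdeal (R ⧸ J)).FG := Ideal.fg_of_isNoetherianRing _
  have hfin := Submodule.FG.finite_generators hfg
  set T := (maximalIdeal (R ⧸ J)).generators with hT
  set g := Function.surjInv (Ideal.Quotient.mk_surjective (I := J)) with hg
  have hgr : ∀ t, Ideal.Quotient.mk J (g t) = t := Function.surjInv_eq _
  have hTspan : Ideal.span T = maximalIdeal (R ⧸ J) := (maximalIdeal (R ⧸ J)).span_generators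
  have hmm := map_maximalIdeal_of_surjective (Ideal.Quotient.mk J) Ideal.Quotient.mk_surjective
  have hJm : J ≤ maximalIdeal R := hJ.trans (Ideal.pow_le_self two_ne_zero)
  have hle : Ideal.span (g '' T) ≤ maximalIdeal R := by
    rw [Ideal.span_le]
    rintro _ ⟨t, ht, rfl⟩
    have : Ideal.Quotient.mk J (g t) ∈ (maximalIdeal R).map (Ideal.Quotient.mk J) := by
      rw [hgr, hmm, ← hTspan]; exact Ideal.subset_span ht
    rwa [Ideal.mem_quotient_iff_mem hJm] at this
  -- The lifted generators generate `𝔪` modulo `J ⊆ 𝔪²`, hence generate `𝔪` by Nakayama's lemma.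
  have hsup : maximalIdeal R ≤ Ideal.span (g '' T) ⊔ maximalIdeal R ^ 2 := by
    have h1 : (Ideal.span (g '' T)).map (Ideal.Quotient.mk J) = maximalIdeal (R ⧸ J) := by
      rw [Ideal.map_span, ← Set.image_comp,
        show Ideal.Quotient.mk J ∘ g = id from funext hgr, Set.image_id, hTspan]
    rw [← hmm] at h1
    have h2 : maximalIdeal R ≤ ((Ideal.span (g '' T)).map (Ideal.Quotient.mk J)).comap
        (Ideal.Quotient.mk J) := h1 ▸ Ideal.le_comap_map
    rw [Ideal.comap_map_of_surjective' _ Ideal.Quotient.mk_surjective, Ideal.mk_ker] at h2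
    exact h2.trans (sup_le_sup_left hJ _)
  have hspan : Ideal.span (g '' T) = maximalIdeal R :=
    le_antisymm hle (Submodule.le_of_le_smul_of_le_jacobson_bot
      (maximalIdeal R).fg_of_isNoetherianRing
      (maximalIdeal_le_jacobson _) (by rwa [smul_eq_mul, ← pow_two]))
  calc _ = (Ideal.span (g '' T)).spanFinrank := by rw [hspan]
    _ ≤ (g '' T).ncard := Submodule.spanFinrank_span_le_ncard_of_finite (hfin.image _)
    _ ≤ T.ncard := Set.ncard_image_le hfin
    _ = _ := Submodule.FG.generators_ncard hfg

/-- A nonzero ideal contained in `𝔪²` lowers the dimension but not the embedding dimension, so the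
quotient by it is not regular. -/
theorem eq_bot_of_isRegularLocalRing_quotient {R : Type u} [CommRing R] [IsRegularLocalRing R]
    {J : Ideal R} (hJ : J ≤ maximalIdeal R ^ 2) (h : IsRegularLocalRing (R ⧸ J)) : J = ⊥ := by
  have := IsRegularLocalRing.isDomain R
  rw [Submodule.eq_bot_iff]
  intro r hr
  by_contra hr0
  have h1 := ringKrullDim_quotient_succ_le_of_nonZeroDivisor (mem_nonZeroDivisors_of_ne_zero hr0)
  have h2 : ringKrullDim (R ⧸ J) ≤ ringKrullDim (R ⧸ Ideal.span {r}) :=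
    ringKrullDim_le_of_surjective (Ideal.Quotient.factor (by simpa [Ideal.span_le] using hr))
      (Ideal.Quotient.factor_surjective _)
  have h3 := spanFinrank_le_quotient hJ
  have h4 := (add_le_add_left h2 1).trans h1
  rw [← IsRegularLocalRing.spanFinrank_maximalIdeal,
    ← IsRegularLocalRing.spanFinrank_maximalIdeal] at h4
  norm_cast at h4
  omega

/-- Two nonsingular germs, one contained in the other, with the same tangent space are equal. -/
theorem le_of_isRegularLocalRing_quotient {R : Type u} [CommRing R] [IsLocalRing R]
    {I J : Ideal R} (hIJ : I ≤ J) (hI : IsRegularLocalRing (R ⧸ I))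
    (hJ : IsRegularLocalRing (R ⧸ J)) (h : J ≤ I ⊔ maximalIdeal R ^ 2) : J ≤ I := by
  have h1 := map_maximalIdeal_of_surjective (Ideal.Quotient.mk I) Ideal.Quotient.mk_surjective
  have h2 : J.map (Ideal.Quotient.mk I) ≤ maximalIdeal (R ⧸ I) ^ 2 := by
    refine (Ideal.map_mono h).trans ?_
    rw [Ideal.map_sup, Ideal.map_quotient_self, bot_sup_eq, Ideal.map_pow, h1]
  have h3 := eq_bot_of_isRegularLocalRing_quotient h2
    (hJ.of_ringEquiv (DoubleQuot.quotQuotEquivQuotOfLE hIJ).symm)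
  rwa [Ideal.map_eq_bot_iff_le_ker, Ideal.mk_ker] at h3

/-! ### Ideals of germs vanishing on a subset -/

section Germs

variable {X : Scheme.{u}}

theorem vanishesOn_iff {A : Set X} {V : X.Opens} {s : Γ(X, V)} :
    VanishesOn A V s ↔ ∀ x ∈ A, x ∉ X.basicOpen s := by
  constructor
  · intro h x hA hx
    have hV := X.basicOpen_le s hx
    exact (Scheme.evaluation_eq_zero_iff_notMem_basicOpen ..).1 (h x hV hA) hx
  · intro h x hx hA
    exact (Scheme.evaluation_eq_zero_iff_notMem_basicOpen ..).2 (h x hA)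

theorem idealAt_anti {A B : Set X} (h : A ⊆ B) (y : X) : idealAt B y ≤ idealAt A y := by
  rintro _ ⟨V, hy, s, hs, rfl⟩
  exact ⟨V, hy, s, fun x hx hA => hs x hx (h hA), rfl⟩

theorem idealAt_le_maximalIdeal {A : Set X} {y : X} (hy : y ∈ A) :
    idealAt A y ≤ maximalIdeal (X.presheaf.stalk y) := by
  rintro _ ⟨V, hV, s, hs, rfl⟩
  rw [mem_maximalIdeal, mem_nonunits_iff]
  intro hu
  exact vanishesOn_iff.1 hs y hy ((X.mem_basicOpen s y hV).2 hu)

theorem mem_vanishingIdeal_iff {C : Closeds X} {V : X.affineOpens} {s : Γ(X, V)} :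
    s ∈ (Scheme.IdealSheafData.vanishingIdeal C).ideal V ↔ VanishesOn (C : Set X) V s := by
  rw [vanishesOn_iff]
  simp only [Scheme.IdealSheafData.vanishingIdeal_ideal, PrimeSpectrum.mem_vanishingIdeal]
  constructor
  · intro h x hx hxs
    obtain ⟨p, rfl⟩ : x ∈ Set.range V.2.fromSpec := by
      rw [V.2.range_fromSpec]; exact X.basicOpen_le s hxs
    have : p ∈ V.2.fromSpec ⁻¹ᵁ X.basicOpen s := hxs
    rw [V.2.fromSpec_preimage_basicOpen] at this
    exact this (h p hx)
  · intro h p hp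
    by_contra hs
    refine h _ hp ?_
    change p ∈ V.2.fromSpec ⁻¹ᵁ X.basicOpen s
    rw [V.2.fromSpec_preimage_basicOpen]
    exact hs

theorem mem_of_forall_mem_vanishingIdeal {C : Closeds X} {V : X.affineOpens} {x : X}
    (hx : x ∈ V.1) (h : ∀ s ∈ (Scheme.IdealSheafData.vanishingIdeal C).ideal V,
      x ∉ X.basicOpen s) : x ∈ C := by
  have : x ∈ (Scheme.IdealSheafData.vanishingIdeal C).support := by
    rw [Scheme.IdealSheafData.mem_support_iff_of_mem hx, Scheme.mem_zeroLocus_iff]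
    exact h
  rwa [← SetLike.mem_coe, Scheme.IdealSheafData.coe_support_vanishingIdeal] at this

/-- If all germs at `y` vanishing on the closed set `C` vanish on `A`, then `A ⊆ C` near `y`: near
`y`, the set `C` is cut out by finitely many equations. -/
theorem exists_inter_subset_of_idealAt_le [IsLocallyNoetherian X] {A C : Set X} (hC : IsClosed C)
    {y : X} (h : idealAt C y ≤ idealAt A y) : ∃ V : X.Opens, y ∈ V ∧ A ∩ V ⊆ C := by
  classical
  obtain ⟨V, hV, hyV, -⟩ := exists_isAffineOpen_mem_and_subset (U := ⊤) (x := y) trivial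
  have := IsLocallyNoetherian.component_noetherian (X := X) ⟨V, hV⟩
  set J := (Scheme.IdealSheafData.vanishingIdeal ⟨C, hC⟩).ideal ⟨V, hV⟩ with hJ
  obtain ⟨S, hS⟩ : J.FG := Ideal.fg_of_isNoetherianRing _
  have key : ∀ s ∈ S, ∃ W : X.Opens, y ∈ W ∧ ∀ x ∈ A ∩ W, x ∉ X.basicOpen s := by
    intro s hs
    have hsJ : s ∈ J := hS ▸ Ideal.subset_span hs
    obtain ⟨W, hyW, t, ht, hst⟩ := h ⟨V, hyV, s, mem_vanishingIdeal_iff.1 hsJ, rfl⟩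
    obtain ⟨W', hyW', i, j, hij⟩ := X.presheaf.germ_eq y hyW hyV t s hst
    refine ⟨W', hyW', fun x hx hxs => ?_⟩
    have h1 := vanishesOn_iff.1 (ht.res i) x hx.1
    rw [hij, Scheme.basicOpen_res] at h1
    exact h1 ⟨hx.2, hxs⟩
  choose! W hyW hW using key
  refine ⟨V ⊓ S.inf W, ⟨hyV, ?_⟩, ?_⟩
  · have : y ∈ ((S.inf W : X.Opens) : Set X) := by
      rw [Opens.coe_finset_inf]
      simpa using hyW
    exact this
  · rintro x ⟨hxA, hxV, hxW⟩
    refine mem_of_forall_mem_vanishingIdeal (C := ⟨C, hC⟩) (V := ⟨V, hV⟩) hxV fun s hs => ?_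
    rw [← Scheme.evaluation_eq_zero_iff_notMem_basicOpen X x hxV]
    have : J ≤ RingHom.ker (X.evaluation V x hxV).hom := by
      rw [← hS]
      refine Submodule.span_le.2 fun t ht => ?_
      refine (Scheme.evaluation_eq_zero_iff_notMem_basicOpen X x hxV t).2 (hW t ht x ⟨hxA, ?_⟩)
      exact (Finset.inf_le (f := W) ht : S.inf W ≤ W t) hxW
    exact this hs

theorem idealAt_le_or_idealAt_le {A C D : Set X} (h : A ⊆ C ∪ D) {y : X}
    (hA : (idealAt A y).IsPrime) : idealAt C y ≤ idealAt A y ∨ idealAt D y ≤ idealAt A y := by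
  rw [← hA.mul_le]
  rw [Ideal.mul_le]
  rintro _ ⟨V, hV, s, hs, rfl⟩ _ ⟨W, hW, t, ht, rfl⟩
  have hVW : y ∈ V ⊓ W := ⟨hV, hW⟩
  refine ⟨V ⊓ W, hVW, X.presheaf.map (homOfLE inf_le_left).op s *
    X.presheaf.map (homOfLE inf_le_right).op t, ?_, ?_⟩
  · intro x hx hxA
    rcases h hxA with hxC | hxD
    · rw [map_mul, hs.res (homOfLE inf_le_left) x hx hxC, zero_mul]
    · rw [map_mul, ht.res (homOfLE inf_le_right) x hx hxD, mul_zero]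
  · rw [map_mul, TopCat.Presheaf.germ_res_apply, TopCat.Presheaf.germ_res_apply]

end Germs

/-! ### Subspaces of the cotangent space as ideals between `𝔪²` and `𝔪` -/

section Conormal

variable {R : Type u} [CommRing R] [IsLocalRing R]

/-- The subspace of `𝔪 / 𝔪²` spanned by the classes of the elements of `I`; only the elements of `I`
lying in `𝔪` contribute. -/
noncomputable def conormal (I : Ideal R) : Submodule (ResidueField R) (CotangentSpace R) :=
  Submodule.span _ ((maximalIdeal R).toCotangent '' {f | (f : R) ∈ I})

/-- The ideal of the elements of `𝔪` whose class in `𝔪 / 𝔪²` lies in `N`. This embeds the subspaces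
of the cotangent space into the ideals, with image the ideals between `𝔪²` and `𝔪`. -/
noncomputable def idealOf (N : Submodule (ResidueField R) (CotangentSpace R)) : Ideal R :=
  ((N.restrictScalars R).comap (maximalIdeal R).toCotangent).map (maximalIdeal R).subtype

theorem mem_idealOf {N : Submodule (ResidueField R) (CotangentSpace R)} {f : R} :
    f ∈ idealOf N ↔ ∃ h : f ∈ maximalIdeal R, (maximalIdeal R).toCotangent ⟨f, h⟩ ∈ N := by
  constructor
  · rintro ⟨g, hg, rfl⟩
    exact ⟨g.2, hg⟩
  · rintro ⟨h, hf⟩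
    exact ⟨⟨f, h⟩, hf, rfl⟩

theorem idealOf_le_idealOf {N P : Submodule (ResidueField R) (CotangentSpace R)} :
    idealOf N ≤ idealOf P ↔ N ≤ P := by
  constructor
  · intro h c hc
    obtain ⟨f, rfl⟩ := (maximalIdeal R).toCotangent_surjective c
    exact (mem_idealOf.1 (h (mem_idealOf.2 ⟨f.2, hc⟩))).2
  · intro h f hf
    obtain ⟨hm, hf⟩ := mem_idealOf.1 hf
    exact mem_idealOf.2 ⟨hm, h hf⟩

theorem idealOf_inf (N P : Submodule (ResidueField R) (CotangentSpace R)) :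
    idealOf (N ⊓ P) = idealOf N ⊓ idealOf P := by
  ext f
  simp only [mem_idealOf, Submodule.mem_inf]
  exact ⟨fun ⟨h, h1, h2⟩ => ⟨⟨h, h1⟩, h, h2⟩, fun ⟨⟨h, h1⟩, _, h2⟩ => ⟨h, h1, h2⟩⟩

theorem idealOf_bot : idealOf (⊥ : Submodule (ResidueField R) (CotangentSpace R)) =
    maximalIdeal R ^ 2 := by
  ext f
  simp only [mem_idealOf, Submodule.mem_bot, Ideal.toCotangent_eq_zero]
  exact ⟨fun ⟨_, h⟩ => h, fun h => ⟨Ideal.pow_le_self two_ne_zero h, h⟩⟩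

theorem conormal_le_iff {I : Ideal R} (hI : I ≤ maximalIdeal R)
    {N : Submodule (ResidueField R) (CotangentSpace R)} : conormal I ≤ N ↔ I ≤ idealOf N := by
  rw [conormal, Submodule.span_le]
  constructor
  · intro h f hf
    exact mem_idealOf.2 ⟨hI hf, h ⟨⟨f, hI hf⟩, hf, rfl⟩⟩
  · rintro h _ ⟨f, hf, rfl⟩
    exact (mem_idealOf.1 (h hf)).2

theorem sq_le_idealOf (N : Submodule (ResidueField R) (CotangentSpace R)) :
    maximalIdeal R ^ 2 ≤ idealOf N := by
  rw [← idealOf_bot]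
  exact idealOf_le_idealOf.2 bot_le

theorem conormal_idealOf (N : Submodule (ResidueField R) (CotangentSpace R)) :
    conormal (idealOf N) = N := by
  refine le_antisymm ((conormal_le_iff ?_).2 le_rfl) ?_
  · exact fun f hf => (mem_idealOf.1 hf).1
  · intro c hc
    obtain ⟨f, rfl⟩ := (maximalIdeal R).toCotangent_surjective c
    exact Submodule.subset_span ⟨f, mem_idealOf.2 ⟨f.2, hc⟩, rfl⟩

/-- Elements of the conormal space of an ideal `I` are represented by elements of `I`. -/
theorem idealOf_conormal {I : Ideal R} (hI : I ≤ maximalIdeal R) :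
    idealOf (conormal I) = I ⊔ maximalIdeal R ^ 2 := by
  refine le_antisymm ?_ (sup_le ((conormal_le_iff hI).1 le_rfl) (sq_le_idealOf _))
  have hle : I ⊔ maximalIdeal R ^ 2 ≤ maximalIdeal R :=
    sup_le hI (Ideal.pow_le_self two_ne_zero)
  intro f hf
  obtain ⟨hm, hf⟩ := mem_idealOf.1 hf
  suffices ∀ c ∈ conormal I, ∃ g ∈ I, ∃ hg : g ∈ maximalIdeal R,
      (maximalIdeal R).toCotangent ⟨g, hg⟩ = c by
    obtain ⟨g, hgI, hg, h⟩ := this _ hf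
    rw [Ideal.toCotangent_eq] at h
    rw [← sub_sub_cancel g f]
    exact sub_mem (Ideal.mem_sup_left hgI) (Ideal.mem_sup_right h)
  intro c hc
  induction hc using Submodule.span_induction with
  | mem c h => obtain ⟨g, hg, rfl⟩ := h; exact ⟨g, hg, g.2, rfl⟩
  | zero => exact ⟨0, zero_mem _, zero_mem _, map_zero _⟩
  | add c d _ _ h1 h2 =>
    obtain ⟨g, hgI, hg, rfl⟩ := h1
    obtain ⟨k, hkI, hk, rfl⟩ := h2
    exact ⟨g + k, add_mem hgI hkI, add_mem hg hk,
      map_add (maximalIdeal R).toCotangent ⟨g, hg⟩ ⟨k, hk⟩⟩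
  | smul a c _ h =>
    obtain ⟨g, hgI, hg, rfl⟩ := h
    obtain ⟨r, rfl⟩ := residue_surjective a
    exact ⟨r * g, Ideal.mul_mem_left _ _ hgI, Ideal.mul_mem_left _ _ hg,
      map_smul (maximalIdeal R).toCotangent r ⟨g, hg⟩⟩

theorem conormal_eq_sup_iff {I J K : Ideal R} (hI : I ≤ maximalIdeal R) (hJ : J ≤ maximalIdeal R)
    (hK : K ≤ maximalIdeal R) : conormal I = conormal J ⊔ conormal K ↔
      I ⊔ maximalIdeal R ^ 2 = J ⊔ K ⊔ maximalIdeal R ^ 2 := by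
  have h : conormal J ⊔ conormal K = conormal (J ⊔ K) := by
    refine le_antisymm (sup_le ?_ ?_) ((conormal_le_iff (sup_le hJ hK)).2 (sup_le ?_ ?_))
    · exact Submodule.span_mono (Set.image_mono fun f hf => Ideal.mem_sup_left hf)
    · exact Submodule.span_mono (Set.image_mono fun f hf => Ideal.mem_sup_right hf)
    · exact (conormal_le_iff hJ).1 le_sup_left
    · exact (conormal_le_iff hK).1 le_sup_right
  rw [h, ← idealOf_conormal hI, ← idealOf_conormal (sup_le hJ hK)]
  exact ⟨fun h => by rw [h], fun h => by rw [← conormal_idealOf (conormal I), h, conormal_idealOf]⟩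

theorem iSupIndep_conormal_iff {ι : Type*} {I : ι → Ideal R} (hI : ∀ i, I i ≤ maximalIdeal R) :
    iSupIndep (fun i => conormal (I i)) ↔ ∀ i, (I i ⊔ maximalIdeal R ^ 2) ⊓
      ((⨆ (j) (_ : j ≠ i), I j) ⊔ maximalIdeal R ^ 2) ≤ maximalIdeal R ^ 2 := by
  rw [iSupIndep_def]
  refine forall_congr' fun i => ?_
  have hle : (⨆ (j) (_ : j ≠ i), I j) ≤ maximalIdeal R := iSup₂_le fun j _ => hI j
  have h : (⨆ (j) (_ : j ≠ i), conormal (I j)) = conormal (⨆ (j) (_ : j ≠ i), I j) := by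
    refine le_antisymm (iSup₂_le fun j hj => ?_) ((conormal_le_iff hle).2 (iSup₂_le fun j hj => ?_))
    · exact Submodule.span_mono (Set.image_mono fun f hf => le_iSup₂ (f := fun j _ => I j) j hj hf)
    · exact (conormal_le_iff (hI j)).1 (le_iSup₂ (f := fun j (_ : j ≠ i) => conormal (I j)) j hj)
  rw [h, disjoint_iff_inf_le, ← idealOf_le_idealOf, idealOf_inf, idealOf_bot,
    idealOf_conormal (hI i), idealOf_conormal hle]

end Conormal

/-! ### Clean and transversal intersection in terms of ideals -/

section Tangent

variable {X : Scheme.{u}}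

theorem tangentAt_eq (A : Set X) (y : X) :
    tangentAt A y = (conormal (idealAt A y)).dualAnnihilator := by
  rfl

theorem tangentAt_eq_inf_iff {A B C : Set X} {y : X} (hA : y ∈ A) (hB : y ∈ B) (hC : y ∈ C) :
    tangentAt A y = tangentAt B y ⊓ tangentAt C y ↔
      idealAt A y ⊔ maximalIdeal (X.presheaf.stalk y) ^ 2 =
        idealAt B y ⊔ idealAt C y ⊔ maximalIdeal (X.presheaf.stalk y) ^ 2 := by
  rw [← conormal_eq_sup_iff (idealAt_le_maximalIdeal hA) (idealAt_le_maximalIdeal hB)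
    (idealAt_le_maximalIdeal hC), tangentAt_eq, tangentAt_eq, tangentAt_eq,
    ← Submodule.dualAnnihilator_sup_eq]
  exact (Subspace.dualAnnihilator_inj)

theorem IntersectCleanly.idealAt_inter_sup {A B : Set X} (h : IntersectCleanly A B) {y : X}
    (hA : y ∈ A) (hB : y ∈ B) (hy : IsClosed ({y} : Set X)) :
    idealAt (A ∩ B) y ⊔ maximalIdeal (X.presheaf.stalk y) ^ 2 =
      idealAt A y ⊔ idealAt B y ⊔ maximalIdeal (X.presheaf.stalk y) ^ 2 :=
  (tangentAt_eq_inf_iff (Set.mem_inter hA hB) hA hB).1 (h.2 y (Set.mem_inter hA hB) hy)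

/-- The conormal spaces of the members of `S` are independent exactly when their ideals are
independent modulo `𝔪²`. -/
theorem iSupIndep_dualCoannihilator_tangentAt_iff {S : Set (Set X)} {y : X} (hy : y ∈ ⋂₀ S) :
    iSupIndep (fun A : S => (tangentAt (A : Set X) y).dualCoannihilator) ↔
      ∀ A ∈ S, (idealAt A y ⊔ maximalIdeal (X.presheaf.stalk y) ^ 2) ⊓
        ((⨆ B ∈ S \ {A}, idealAt B y) ⊔ maximalIdeal (X.presheaf.stalk y) ^ 2) ≤
          maximalIdeal (X.presheaf.stalk y) ^ 2 := by
  have h : (fun A : S => (tangentAt (A : Set X) y).dualCoannihilator) =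
      fun A : S => conormal (idealAt (A : Set X) y) := by
    funext A
    rw [tangentAt_eq]
    exact Subspace.dualAnnihilator_dualCoannihilator_eq
  rw [h, iSupIndep_conormal_iff fun A : S => idealAt_le_maximalIdeal (hy A A.2), Subtype.forall]
  refine forall₂_congr fun A hA => ?_
  have : (⨆ (j : S) (_ : j ≠ ⟨A, hA⟩), idealAt (j : Set X) y) = ⨆ B ∈ S \ {A}, idealAt B y := by
    refine le_antisymm (iSup₂_le fun B hB => ?_) (iSup₂_le fun B hB => ?_)
    · exact le_iSup₂ (f := fun B (_ : B ∈ S \ {A}) => idealAt B y) B.1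
        ⟨B.2, fun h => hB (Subtype.ext h)⟩
    · exact le_iSup₂ (f := fun (j : S) (_ : j ≠ ⟨A, hA⟩) => idealAt (j : Set X) y) ⟨B, hB.1⟩
        fun h => hB.2 (congrArg Subtype.val h)
  rw [this]

end Tangent

/-! ### Nonsingular connected closed subsets are irreducible -/

section Irreducible

theorem subset_of_inter_subset {T : Type*} [TopologicalSpace T] {C D U : Set T}
    (hC : IsPreirreducible C) (hD : IsClosed D) (hU : IsOpen U) (hne : (C ∩ U).Nonempty)
    (h : C ∩ U ⊆ D) : C ⊆ D :=
  (subset_closure_inter_of_isPreirreducible_of_isOpen hC hU hne).trans (hD.closure_subset_iff.2 h)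

variable {X : Scheme.{u}}

theorem IsNonsingularSubset.isPrime_idealAt {A : Set X} (h : IsNonsingularSubset A) {y : X}
    (hyA : y ∈ A) (hy : IsClosed ({y} : Set X)) : (idealAt A y).IsPrime := by
  have := h y hyA hy
  exact (Ideal.Quotient.isDomain_iff_prime _).1 (IsRegularLocalRing.isDomain _)

/-- Let `C` be an irreducible component of the set and `D` the union of the others. The ideal of the
set at a closed point is prime, so near each closed point the set is contained in `C` or in `D`; by
connectedness one of the two contains the whole set. -/
theorem IsNonsingularSubset.isIrreducible [IsNoetherian X] [JacobsonSpace X] {A : Set X}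
    (h : IsNonsingularSubset A) (hA : IsClosed A) (hconn : _root_.IsConnected A) :
    IsIrreducible A := by
  obtain ⟨S, hSfin, hScl, hSirr, rfl⟩ := NoetherianSpace.exists_finite_set_isClosed_irreducible hA
  obtain ⟨x, C₀, hC₀, -⟩ := hconn.nonempty
  obtain ⟨C, hCmax⟩ := hSfin.exists_maximal ⟨C₀, hC₀⟩
  have hCS := hCmax.prop
  set D : Set X := ⋃₀ {T ∈ S | ¬ T ⊆ C} with hD
  have hDfin : {T ∈ S | ¬ T ⊆ C}.Finite := hSfin.subset (Set.sep_subset _ _)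
  have hDcl : IsClosed D := by
    rw [hD, Set.sUnion_eq_biUnion]
    exact hDfin.isClosed_biUnion fun T hT => hScl T hT.1
  have hCD : ¬ C ⊆ D := by
    intro hCD
    obtain ⟨T, hT, hCT⟩ := isIrreducible_iff_sUnion_isClosed.1 (hSirr C hCS) hDfin.toFinset
      (fun T hT => hScl T ((hDfin.mem_toFinset.1 hT).1)) (by simpa using hCD)
    obtain ⟨hTS, hTC⟩ := hDfin.mem_toFinset.1 hT
    exact hTC (hCmax.le_of_ge hTS hCT)
  have hcov : ⋃₀ S ⊆ C ∪ D := by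
    rintro x ⟨T, hT, hx⟩
    by_cases hTC : T ⊆ C
    · exact Or.inl (hTC hx)
    · exact Or.inr ⟨T, ⟨hT, hTC⟩, hx⟩
  -- The largest open sets in which the given set is contained in `C`, respectively in `D`.
  set u : Set X := ⋃₀ {V | IsOpen V ∧ ⋃₀ S ∩ V ⊆ C} with hu
  set v : Set X := ⋃₀ {V | IsOpen V ∧ ⋃₀ S ∩ V ⊆ D} with hv
  have huo : IsOpen u := isOpen_sUnion fun V hV => hV.1
  have hvo : IsOpen v := isOpen_sUnion fun V hV => hV.1
  have huv : ⋃₀ S ⊆ u ∪ v := by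
    by_contra hne
    obtain ⟨x, hxA, hxn⟩ := Set.not_subset.1 hne
    obtain ⟨y, ⟨hyA, hyn⟩, hy⟩ := nonempty_inter_closedPoints (Z := ⋃₀ S \ (u ∪ v)) ⟨x, hxA, hxn⟩
      (hA.sdiff (huo.union hvo)).isLocallyClosed
    rcases idealAt_le_or_idealAt_le hcov (h.isPrime_idealAt hyA hy) with h1 | h1
    · obtain ⟨V, hyV, hV⟩ := exists_inter_subset_of_idealAt_le (hScl C hCS) h1
      exact hyn (Or.inl ⟨V, ⟨V.2, hV⟩, hyV⟩)
    · obtain ⟨V, hyV, hV⟩ := exists_inter_subset_of_idealAt_le hDcl h1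
      exact hyn (Or.inr ⟨V, ⟨V.2, hV⟩, hyV⟩)
  have huC : ⋃₀ S ∩ u ⊆ C := by
    rintro x ⟨hx, V, ⟨-, hV⟩, hxV⟩
    exact hV ⟨hx, hxV⟩
  have hvD : ⋃₀ S ∩ v ⊆ D := by
    rintro x ⟨hx, V, ⟨-, hV⟩, hxV⟩
    exact hV ⟨hx, hxV⟩
  have hCsub : C ⊆ ⋃₀ S := Set.subset_sUnion_of_mem hCS
  by_cases hune : (⋃₀ S ∩ u).Nonempty
  · by_cases hvne : (⋃₀ S ∩ v).Nonempty
    · obtain ⟨x, hx, hxu, hxv⟩ := hconn.isPreconnected u v huo hvo huv hune hvne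
      exact absurd (subset_of_inter_subset (hSirr C hCS).isPreirreducible hDcl (huo.inter hvo)
        ⟨x, huC ⟨hx, hxu⟩, hxu, hxv⟩ fun z hz => hvD ⟨hCsub hz.1, hz.2.2⟩) hCD
    · have : ⋃₀ S = C := by
        refine subset_antisymm (fun z hz => huC ⟨hz, (huv hz).resolve_right fun hzv => ?_⟩) hCsub
        exact hvne ⟨z, hz, hzv⟩
      exact this ▸ hSirr C hCS
  · refine absurd (fun z hz => hvD ⟨hCsub hz, ?_⟩) hCD
    exact (huv (hCsub hz)).resolve_left fun hzu => hune ⟨z, hCsub hz, hzu⟩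

end Irreducible

/-! ### Transfer along closed immersions -/

section ClosedImmersion

variable {X Y : Scheme.{u}} (f : Y ⟶ X) [IsClosedImmersion f]

/-- A germ on `X` vanishes on the image of `B` exactly when its restriction to `Y` vanishes on `B`;
the topology of `Y` is induced from `X`. -/
theorem comap_stalkMap_idealAt (B : Set Y) (y : Y) :
    (idealAt B y).comap (f.stalkMap y).hom = idealAt (f '' B) (f y) := by
  ext a
  rw [Ideal.mem_comap]
  constructor
  · rintro ⟨W, hyW, t, ht, hta⟩
    obtain ⟨V, hV, s, rfl⟩ := X.presheaf.exists_germ_eq a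
    erw [Scheme.Hom.germ_stalkMap_apply] at hta
    obtain ⟨W', hyW', i, j, hij⟩ := Y.presheaf.germ_eq y hyW hV t _ hta
    obtain ⟨V', hV', hVW'⟩ := f.isEmbedding.isOpen_iff.1 W'.2
    have hyV' : f y ∈ V' := by
      have : y ∈ f ⁻¹' V' := hVW' ▸ hyW'
      exact this
    refine ⟨V ⊓ ⟨V', hV'⟩, ⟨hV, hyV'⟩, X.presheaf.map (homOfLE inf_le_left).op s, ?_,
      TopCat.Presheaf.germ_res_apply ..⟩
    rw [vanishesOn_iff]
    rintro _ ⟨b, hb, rfl⟩ hbs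
    rw [Scheme.basicOpen_res] at hbs
    have h1 := vanishesOn_iff.1 (ht.res i) b hb
    rw [hij, Scheme.basicOpen_res, ← Scheme.preimage_basicOpen] at h1
    refine h1 ⟨?_, hbs.2⟩
    have : b ∈ f ⁻¹' V' := hbs.1.2
    exact (Set.ext_iff.1 hVW' b).1 this
  · rintro ⟨V, hV, s, hs, rfl⟩
    refine ⟨f ⁻¹ᵁ V, hV, f.app V s, ?_, ?_⟩
    · rw [vanishesOn_iff]
      intro b hb hbs
      rw [← Scheme.preimage_basicOpen] at hbs
      exact vanishesOn_iff.1 hs _ ⟨b, hb, rfl⟩ hbs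
    · exact (Scheme.Hom.germ_stalkMap_apply ..).symm

theorem idealAt_eq_map (B : Set Y) (y : Y) :
    idealAt B y = (idealAt (f '' B) (f y)).map (f.stalkMap y).hom := by
  rw [← comap_stalkMap_idealAt, Ideal.map_comap_of_surjective _ (f.stalkMap_surjective y)]

theorem isClosed_singleton_image {y : Y} (hy : IsClosed ({y} : Set Y)) :
    IsClosed ({f y} : Set X) := by
  rw [← Set.image_singleton]
  exact f.isClosedEmbedding.isClosedMap _ hy

theorem map_maximalIdeal_stalkMap (y : Y) :
    (maximalIdeal (X.presheaf.stalk (f y))).map (f.stalkMap y).hom =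
      maximalIdeal (Y.presheaf.stalk y) :=
  map_maximalIdeal_of_surjective _ (f.stalkMap_surjective y)

variable {f}

theorem IsNonsingularSubset.of_image {B : Set Y} (h : IsNonsingularSubset (f '' B)) :
    IsNonsingularSubset B := by
  intro y hyB hy
  have h1 := h (f y) ⟨y, hyB, rfl⟩ (isClosed_singleton_image f hy)
  have hsurj : Function.Surjective ((Ideal.Quotient.mk (idealAt B y)).comp (f.stalkMap y).hom) :=
    Ideal.Quotient.mk_surjective.comp (f.stalkMap_surjective y)
  refine h1.of_ringEquiv ((Ideal.quotEquivOfEq ?_).trans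
    (RingHom.quotientKerEquivOfSurjective hsurj))
  rw [← comap_stalkMap_idealAt, ← RingHom.comap_ker, Ideal.mk_ker]

theorem IntersectCleanly.of_image {A B : Set Y} (h : IntersectCleanly (f '' A) (f '' B)) :
    IntersectCleanly A B := by
  have hinter := Set.image_inter (s := A) (t := B) f.isClosedEmbedding.injective
  refine ⟨IsNonsingularSubset.of_image (f := f) (hinter ▸ h.1), fun y hyAB hy => ?_⟩
  have h1 := h.idealAt_inter_sup (Set.mem_image_of_mem f hyAB.1) (Set.mem_image_of_mem f hyAB.2)
    (isClosed_singleton_image f hy)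
  rw [tangentAt_eq_inf_iff hyAB hyAB.1 hyAB.2, idealAt_eq_map f, idealAt_eq_map f A,
    idealAt_eq_map f B, ← map_maximalIdeal_stalkMap f, ← Ideal.map_pow, ← Ideal.map_sup,
    ← Ideal.map_sup, ← Ideal.map_sup, hinter, h1]

end ClosedImmersion

/-! ### The inclusion of a closed subvariety -/

section Reduced

variable {X : Scheme.{u}} (Z : Closeds X)

instance : IsClosedImmersion (inclusion Z) :=
  inferInstanceAs (IsClosedImmersion (Scheme.IdealSheafData.subschemeι _))

theorem range_inclusion : Set.range (inclusion Z) = Z :=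
  (Scheme.IdealSheafData.range_subschemeι _).trans
    (Scheme.IdealSheafData.coe_support_vanishingIdeal Z)

/-- The local ring of the reduced closed subscheme `Z` is the quotient of the local ring of `X` by
the ideal of germs vanishing on `Z`. -/
theorem ker_stalkMap_inclusion (y : asVariety Z) :
    RingHom.ker ((inclusion Z).stalkMap y).hom = idealAt (Z : Set X) (inclusion Z y) := by
  have hle : RingHom.ker ((inclusion Z).stalkMap y).hom ≤ idealAt (Z : Set X) (inclusion Z y) := by
    rw [← range_inclusion, ← Set.image_univ, ← comap_stalkMap_idealAt]
    exact Ideal.comap_mono bot_le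
  refine le_antisymm hle ?_
  rintro _ ⟨V, hV, s, hs, rfl⟩
  obtain ⟨W, hW, hyW, hWV⟩ := exists_isAffineOpen_mem_and_subset (U := V) hV
  have h1 := mem_vanishingIdeal_iff (V := ⟨W, hW⟩).2 (hs.res (homOfLE hWV))
  rw [← Scheme.IdealSheafData.ker_subschemeι_app] at h1
  have h2 : (inclusion Z).app W (X.presheaf.map (homOfLE hWV).op s) = 0 := h1
  rw [RingHom.mem_ker, ← TopCat.Presheaf.germ_res_apply X.presheaf (homOfLE hWV) _ hyW s]
  erw [Scheme.Hom.germ_stalkMap_apply, h2, map_zero]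

end Reduced

/-! ### Connected components -/

section Components

variable {T : Type*} [TopologicalSpace T]

theorem isClosed_of_mem_components {F C : Set T} (hF : IsClosed F) (hC : C ∈ components F) :
    IsClosed C := by
  obtain ⟨x, hx, rfl⟩ := hC
  have hsub : closure (connectedComponentIn F x) ⊆ F :=
    hF.closure_subset_iff.2 (connectedComponentIn_subset F x)
  refine isClosed_of_closure_subset ?_
  exact isPreconnected_connectedComponentIn.closure.subset_connectedComponentIn
    (subset_closure (mem_connectedComponentIn hx)) hsub

theorem isConnected_of_mem_components {F C : Set T} (hC : C ∈ components F) :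
    _root_.IsConnected C := by
  obtain ⟨x, hx, rfl⟩ := hC
  exact isConnected_connectedComponentIn_iff.2 hx

theorem subset_of_mem_components {F C : Set T} (hC : C ∈ components F) : C ⊆ F := by
  obtain ⟨x, hx, rfl⟩ := hC
  exact connectedComponentIn_subset F x

theorem eq_of_mem_components {F C : Set T} (hC : C ∈ components F) (hF : IsPreconnected F) :
    C = F := by
  obtain ⟨x, hx, rfl⟩ := hC
  exact hF.connectedComponentIn hx

theorem mem_components_self {F : Set T} (hF : _root_.IsConnected F) : F ∈ components F := by
  obtain ⟨x, hx⟩ := hF.nonempty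
  exact ⟨x, hx, (hF.isPreconnected.connectedComponentIn hx).symm⟩

theorem subset_of_mem_components_of_inter_nonempty {F C D : Set T} (hC : C ∈ components F)
    (hD : IsPreconnected D) (hDF : D ⊆ F) (hne : (C ∩ D).Nonempty) : D ⊆ C := by
  obtain ⟨x, hx, rfl⟩ := hC
  obtain ⟨y, hyC, hyD⟩ := hne
  rw [connectedComponentIn_eq hyC]
  exact hD.subset_connectedComponentIn hyD hDF

/-- If `F ∩ U` is connected, then only one component of `F` meets `U`. -/
theorem inter_eq_of_mem_components {F C U : Set T} (hC : C ∈ components F)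
    (hF : IsPreconnected (F ∩ U)) (hne : (C ∩ U).Nonempty) : C ∩ U = F ∩ U := by
  have hCF := subset_of_mem_components hC
  refine subset_antisymm (Set.inter_subset_inter_left _ hCF)
    (Set.subset_inter ?_ Set.inter_subset_right)
  exact subset_of_mem_components_of_inter_nonempty hC hF Set.inter_subset_left
    (hne.mono fun z hz => ⟨hz.1, hCF hz.1, hz.2⟩)

theorem image_mem_components {T' : Type*} [TopologicalSpace T'] {f : T → T'}
    (hf : Topology.IsInducing f) {F C : Set T} (hC : C ∈ components F) :
    f '' C ∈ components (f '' F) := by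
  obtain ⟨x, hx, rfl⟩ := hC
  refine ⟨f x, ⟨x, hx, rfl⟩, subset_antisymm ?_ ?_⟩
  · exact (isPreconnected_connectedComponentIn.image f hf.continuous.continuousOn
      ).subset_connectedComponentIn ⟨x, mem_connectedComponentIn hx, rfl⟩
      (Set.image_mono (connectedComponentIn_subset F x))
  · set D := connectedComponentIn (f '' F) (f x) with hD
    have hDF : D ⊆ f '' F := connectedComponentIn_subset _ _
    have h1 : f '' (F ∩ f ⁻¹' D) = D := by
      rw [Set.image_inter_preimage, Set.inter_eq_right.2 hDF]
    have h2 : IsPreconnected (F ∩ f ⁻¹' D) := by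
      rw [← hf.isPreconnected_image, h1]; exact isPreconnected_connectedComponentIn
    rw [← h1]
    exact Set.image_mono (h2.subset_connectedComponentIn
      ⟨hx, mem_connectedComponentIn ⟨x, hx, rfl⟩⟩ Set.inter_subset_left)

end Components

/-! ### Building sets over an open set -/

section BuildingSets

variable {X : Scheme.{u}}

theorem iSupIndep_of_subset {α β : Type*} [CompleteLattice α] {t : β → α} {S S' : Set β}
    (hS : S' ⊆ S) (h : iSupIndep fun A : S => t A) : iSupIndep fun A : S' => t A :=
  iSupIndep.comp (t := fun A : S => t A) h (Set.inclusion_injective hS)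

/-- The conditions that make the restriction of `𝒢` to `U` a building set of a simple arrangement,
expressed through the sets `⋂₀ S ∩ U` with `S ⊆ 𝒢` nonempty: over `U` these have to be connected, so
that no connected components of intersections occur. -/
structure IsBuildingSetOn (𝒢 : Set (Set X)) (U : X.Opens) : Prop where
  preconnected : ∀ S ⊆ 𝒢, S.Nonempty → (⋂₀ S ∩ U).Nonempty → IsPreconnected (⋂₀ S ∩ U)
  nonsingular : ∀ S ⊆ 𝒢, S.Nonempty → (⋂₀ S ∩ U).Nonempty → IsNonsingularSubset (⋂₀ S ∩ U)
  proper : ∀ A ∈ 𝒢, (A ∩ U).Nonempty → A ∩ U ≠ U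
  clean : ∀ S ⊆ 𝒢, S.Nonempty → (⋂₀ S ∩ U).Nonempty → ∀ T ⊆ 𝒢, T.Nonempty →
    (⋂₀ T ∩ U).Nonempty → IntersectCleanly (⋂₀ S ∩ U) (⋂₀ T ∩ U)
  transversal : ∀ S ⊆ 𝒢, S.Nonempty → (⋂₀ S ∩ U).Nonempty → ⋂₀ S ∩ U ∉ restrict 𝒢 U →
    IntersectTransversally (factors (restrict 𝒢 U) (⋂₀ S ∩ U))
  inter : ∀ S ⊆ 𝒢, S.Nonempty → (⋂₀ S ∩ U).Nonempty → ⋂₀ S ∩ U ∉ restrict 𝒢 U →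
    ⋂₀ factors (restrict 𝒢 U) (⋂₀ S ∩ U) = ⋂₀ S ∩ U

theorem IsBuildingSetOn.intersectCleanly {𝒢 : Set (Set X)} {U : X.Opens}
    (hU : IsBuildingSetOn 𝒢 U) {A B : Set X} (hA : A ∈ 𝒢) (hB : B ∈ 𝒢)
    (hAU : (A ∩ (U : Set X)).Nonempty) (hBU : (B ∩ (U : Set X)).Nonempty) :
    IntersectCleanly (A ∩ U) (B ∩ U) := by
  have := hU.clean {A} (by simpa using hA) (Set.singleton_nonempty _) (by simpa using hAU)
    {B} (by simpa using hB) (Set.singleton_nonempty _) (by simpa using hBU)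
  simpa only [Set.sInter_singleton] using this

theorem restrict_finite {Λ : Set (Set X)} (h : Λ.Finite) (U : X.Opens) : (restrict Λ U).Finite := by
  refine (h.image fun B => B ∩ (U : Set X)).subset ?_
  rintro A ⟨-, B, hB, rfl⟩
  exact ⟨B, hB, rfl⟩

theorem mem_factors {𝒢 : Set (Set X)} {L F : Set X} :
    F ∈ factors 𝒢 L ↔ Minimal (fun K => K ∈ 𝒢 ∧ L ⊆ K) F := Iff.rfl

theorem subset_of_mem_factors {𝒢 : Set (Set X)} {L F : Set X} (hF : F ∈ factors 𝒢 L) : L ⊆ F :=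
  (mem_factors.1 hF).prop.2

theorem factors_subset {𝒢 : Set (Set X)} {L : Set X} : factors 𝒢 L ⊆ 𝒢 :=
  fun _ hF => (mem_factors.1 hF).prop.1

theorem exists_factor_subset {𝒢 : Set (Set X)} (h : 𝒢.Finite) {L G : Set X} (hG : G ∈ 𝒢)
    (hL : L ⊆ G) : ∃ F ∈ factors 𝒢 L, F ⊆ G := by
  obtain ⟨F, hFG, hF⟩ := (h.subset (Set.sep_subset 𝒢 fun K => L ⊆ K)).exists_le_minimal ⟨hG, hL⟩
  exact ⟨F, hF, hFG⟩

namespace IsBuildingSet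

variable {𝒢 : Set (Set X)} (h : IsBuildingSet 𝒢)
include h

theorem isIrreducible_of_mem_inducedArrangement [IsNoetherian X] [JacobsonSpace X] {A : Set X}
    (hA : A ∈ inducedArrangement 𝒢) : IsIrreducible A := by
  have h1 := h.arrangement.subvariety A hA
  obtain ⟨C, hC, rfl⟩ := h1.closed
  have h2 : C ∩ ((⊤ : X.Opens) : Set X) = C := by simp
  exact h1.nonsingular.isIrreducible (h2.symm ▸ hC) h1.connected

theorem isIrreducible [IsNoetherian X] [JacobsonSpace X] {A : Set X} (hA : A ∈ 𝒢) :
    IsIrreducible A :=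
  h.isIrreducible_of_mem_inducedArrangement (h.building.subset hA)

theorem subset_of_inter_subset [IsNoetherian X] [JacobsonSpace X] {A D : Set X} {U : X.Opens}
    (hA : A ∈ 𝒢) (hD : IsClosed D) (hne : (A ∩ U).Nonempty) (hAD : A ∩ U ⊆ D) : A ⊆ D :=
  SubvarietyArrangement.subset_of_inter_subset (h.isIrreducible hA).isPreirreducible hD U.2 hne hAD

/-- Over an open set where the induced arrangement is simple, every nonempty intersection of members
of `𝒢` belongs to it. -/
theorem isBuildingSetOn {U : X.Opens}
    (hU : IsSimpleArrangement U (restrict (inducedArrangement 𝒢) U))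
    (hU' : IsSimpleBuildingSetFor (restrict (inducedArrangement 𝒢) U) (restrict 𝒢 U)) :
    IsBuildingSetOn 𝒢 U := by
  have key : ∀ S : Set (Set X), S.Finite → S ⊆ 𝒢 → S.Nonempty → (⋂₀ S ∩ (U : Set X)).Nonempty →
      ⋂₀ S ∩ (U : Set X) ∈ restrict (inducedArrangement 𝒢) U := by
    intro S hS
    induction S, hS using Set.Finite.induction_on with
    | empty => exact fun _ h => absurd h Set.not_nonempty_empty
    | @insert a S ha hS ih =>
      intro hsub _ hne
      rw [Set.sInter_insert] at hne ⊢
      have haG : a ∈ 𝒢 := hsub (Set.mem_insert _ _)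
      have haU : a ∩ (U : Set X) ∈ restrict (inducedArrangement 𝒢) U :=
        ⟨hne.mono (Set.inter_subset_inter_left _ Set.inter_subset_left), a,
          h.building.subset haG, rfl⟩
      rcases S.eq_empty_or_nonempty with rfl | hSne
      · simpa using haU
      · have h1 := ih ((Set.subset_insert _ _).trans hsub) hSne
          (hne.mono (Set.inter_subset_inter_left _ Set.inter_subset_right))
        have h2 : a ∩ (U : Set X) ∩ (⋂₀ S ∩ U) = a ∩ ⋂₀ S ∩ U := by
          rw [← Set.inter_inter_distrib_right]
        rcases hU.inter _ haU _ h1 with h3 | h3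
        · rwa [h2] at h3
        · rw [h2] at h3
          exact absurd h3 hne.ne_empty
  have key' : ∀ S ⊆ 𝒢, S.Nonempty → (⋂₀ S ∩ (U : Set X)).Nonempty →
      ⋂₀ S ∩ (U : Set X) ∈ restrict (inducedArrangement 𝒢) U :=
    fun S hS => key S (h.finite.subset hS) hS
  refine ⟨?_, ?_, ?_, ?_, ?_, ?_⟩
  · exact fun S hS h1 h2 => (hU.subvariety _ (key' S hS h1 h2)).connected.isPreconnected
  · exact fun S hS h1 h2 => (hU.subvariety _ (key' S hS h1 h2)).nonsingular
  · intro A hA hne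
    exact (hU.subvariety _ ⟨hne, A, h.building.subset hA, rfl⟩).proper.ne
  · exact fun S hS h1 h2 T hT h3 h4 => hU.clean _ (key' S hS h1 h2) _ (key' T hT h3 h4)
  · exact fun S hS h1 h2 h3 => hU'.transversal _ ⟨key' S hS h1 h2, h3⟩
  · exact fun S hS h1 h2 h3 => hU'.inter _ ⟨key' S hS h1 h2, h3⟩

theorem exists_cover : ∃ 𝒰 : Set X.Opens, sSup 𝒰 = ⊤ ∧ ∀ U ∈ 𝒰, IsBuildingSetOn 𝒢 U := by
  obtain ⟨𝒰, h1, h2⟩ := h.building.cover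
  exact ⟨𝒰, h1, fun U hU => h.isBuildingSetOn (h2 U hU).1 (h2 U hU).2⟩

end IsBuildingSet

/-- The conditions of `IsBuildingSetOn` over an open cover, together with finiteness of the induced
arrangement and nonsingularity and cleanness of its members, suffice for a building set; that
intersections of members are disjoint unions of members is automatic for connected components. -/
theorem IsBuildingSet.of_cover {𝒢 : Set (Set X)} (hfin : (inducedArrangement 𝒢).Finite)
    (hclosed : ∀ A ∈ 𝒢, IsClosed A) (hconn : ∀ A ∈ 𝒢, _root_.IsConnected A)
    (hns : ∀ A ∈ inducedArrangement 𝒢, IsNonsingularSubset A)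
    (hproper : ∀ A ∈ 𝒢, A ≠ Set.univ)
    (hclean : ∀ A ∈ inducedArrangement 𝒢, ∀ B ∈ inducedArrangement 𝒢, IntersectCleanly A B)
    (hcover : ∃ 𝒰 : Set X.Opens, sSup 𝒰 = ⊤ ∧ ∀ U ∈ 𝒰, IsBuildingSetOn 𝒢 U) :
    IsBuildingSet 𝒢 := by
  have hsub : 𝒢 ⊆ inducedArrangement 𝒢 := fun A hA =>
    ⟨{A}, by simpa using hA, Set.singleton_nonempty _, by
      simpa using mem_components_self (hconn A hA)⟩
  refine ⟨hfin.subset hsub, hclosed, hconn, ⟨hfin, ?_, hclean, ?_⟩, hsub, ?_⟩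
  · rintro A hA
    obtain ⟨S, hS, ⟨G, hG⟩, hAS⟩ := id hA
    refine ⟨⟨A, isClosed_of_mem_components (isClosed_sInter fun B hB => hclosed B (hS hB)) hAS,
      by simp⟩, isConnected_of_mem_components hAS, hns A hA, ?_⟩
    rw [Opens.coe_top, Set.ssubset_univ_iff]
    rintro rfl
    exact hproper G (hS hG) (Set.univ_subset_iff.1 ((subset_of_mem_components hAS).trans
      (Set.sInter_subset_of_mem hG)))
  · rintro A ⟨S, hS, hSne, hA⟩ B ⟨T, hT, hTne, hB⟩
    refine ⟨{C ∈ components (⋂₀ (S ∪ T)) | C ⊆ A ∩ B}, ?_, ?_, ?_⟩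
    · exact fun C hC => ⟨S ∪ T, Set.union_subset hS hT, hSne.inl, hC.1⟩
    · intro C hC D hD hne
      rw [Function.onFun, id, id, Set.disjoint_iff_inter_eq_empty]
      by_contra hCD
      replace hCD := Set.nonempty_iff_ne_empty.2 hCD
      refine hne (subset_antisymm ?_ ?_)
      · exact subset_of_mem_components_of_inter_nonempty hD.1
          (isConnected_of_mem_components hC.1).isPreconnected (subset_of_mem_components hC.1)
          (Set.inter_comm C D ▸ hCD)
      · exact subset_of_mem_components_of_inter_nonempty hC.1
          (isConnected_of_mem_components hD.1).isPreconnected (subset_of_mem_components hD.1) hCD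
    · refine subset_antisymm (fun x hx => ?_) (Set.sUnion_subset fun C hC => hC.2)
      have hxST : x ∈ ⋂₀ (S ∪ T) := by
        rw [Set.sInter_union]
        exact ⟨subset_of_mem_components hA hx.1, subset_of_mem_components hB hx.2⟩
      have hC : connectedComponentIn (⋂₀ (S ∪ T)) x ∈ components (⋂₀ (S ∪ T)) := ⟨x, hxST, rfl⟩
      have hxC := mem_connectedComponentIn hxST
      have hCsub : connectedComponentIn (⋂₀ (S ∪ T)) x ⊆ ⋂₀ S ∩ ⋂₀ T :=
        (subset_of_mem_components hC).trans (Set.sInter_union S T).subset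
      refine ⟨_, ⟨hC, Set.subset_inter ?_ ?_⟩, hxC⟩
      · exact subset_of_mem_components_of_inter_nonempty hA isPreconnected_connectedComponentIn
          (fun z hz => (hCsub hz).1) ⟨x, hx.1, hxC⟩
      · exact subset_of_mem_components_of_inter_nonempty hB isPreconnected_connectedComponentIn
          (fun z hz => (hCsub hz).2) ⟨x, hx.2, hxC⟩
  · obtain ⟨𝒰, hcov, hU⟩ := hcover
    refine ⟨𝒰, hcov, fun U hUU => ?_⟩
    have hon := hU U hUU
    have key : ∀ A ∈ restrict (inducedArrangement 𝒢) U, ∃ S ⊆ 𝒢, S.Nonempty ∧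
        (⋂₀ S ∩ (U : Set X)).Nonempty ∧ A = ⋂₀ S ∩ U := by
      rintro _ ⟨hne, C, ⟨S, hS, hSne, hC⟩, rfl⟩
      have hne' : (⋂₀ S ∩ (U : Set X)).Nonempty :=
        hne.mono (Set.inter_subset_inter_left _ (subset_of_mem_components hC))
      exact ⟨S, hS, hSne, hne', inter_eq_of_mem_components hC (hon.preconnected S hS hSne hne') hne⟩
    have key' : ∀ S ⊆ 𝒢, S.Nonempty → (⋂₀ S ∩ (U : Set X)).Nonempty →
        ⋂₀ S ∩ (U : Set X) ∈ restrict (inducedArrangement 𝒢) U := by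
      intro S hS hSne hne
      obtain ⟨x, hx, hxU⟩ := hne
      have hC : connectedComponentIn (⋂₀ S) x ∈ components (⋂₀ S) := ⟨x, hx, rfl⟩
      refine ⟨⟨x, hx, hxU⟩, _, ⟨S, hS, hSne, hC⟩, ?_⟩
      exact (inter_eq_of_mem_components hC (hon.preconnected S hS hSne ⟨x, hx, hxU⟩)
        ⟨x, mem_connectedComponentIn hx, hxU⟩).symm
    refine ⟨⟨restrict_finite hfin U, ?_, ?_, ?_⟩, ?_, ?_, ?_⟩
    · intro A hA
      obtain ⟨S, hS, ⟨G, hG⟩, hne, rfl⟩ := key A hA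
      have hGne : (G ∩ (U : Set X)).Nonempty :=
        hne.mono (Set.inter_subset_inter_left _ (Set.sInter_subset_of_mem hG))
      refine ⟨⟨⋂₀ S, isClosed_sInter fun B hB => hclosed B (hS hB), rfl⟩,
        ⟨hne, hon.preconnected S hS ⟨G, hG⟩ hne⟩, hon.nonsingular S hS ⟨G, hG⟩ hne,
        Set.inter_subset_right, fun hUS => hon.proper G (hS hG) hGne ?_⟩
      exact subset_antisymm Set.inter_subset_right (hUS.trans
        (Set.inter_subset_inter_left _ (Set.sInter_subset_of_mem hG)))
    · intro A hA B hB
      obtain ⟨S, hS, hSne, hS', rfl⟩ := key A hA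
      obtain ⟨T, hT, hTne, hT', rfl⟩ := key B hB
      exact hon.clean S hS hSne hS' T hT hTne hT'
    · intro A hA B hB
      obtain ⟨S, hS, hSne, hS', rfl⟩ := key A hA
      obtain ⟨T, hT, hTne, hT', rfl⟩ := key B hB
      rw [← Set.inter_inter_distrib_right, ← Set.sInter_union]
      rcases (⋂₀ (S ∪ T) ∩ (U : Set X)).eq_empty_or_nonempty with h0 | h0
      · exact Or.inr h0
      · exact Or.inl (key' _ (Set.union_subset hS hT) hSne.inl h0)
    · rintro _ ⟨hne, G, hG, rfl⟩
      exact ⟨hne, G, hsub hG, rfl⟩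
    · rintro L ⟨hL, hLn⟩
      obtain ⟨S, hS, hSne, hS', rfl⟩ := key L hL
      exact hon.transversal S hS hSne hS' hLn
    · rintro L ⟨hL, hLn⟩
      obtain ⟨S, hS, hSne, hS', rfl⟩ := key L hL
      exact hon.inter S hS hSne hS' hLn

/-- As `𝒢'` is closed downwards, every factor in `𝒢'` of an intersection `L` of members of `𝒢'` is
also a factor of `L` in `𝒢`, so transversality is inherited; and these factors have intersection
`L`, since each of the given members contains one of them. -/
theorem IsBuildingSetOn.mono [IsNoetherian X] [JacobsonSpace X] {𝒢 𝒢' : Set (Set X)}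
    (h : IsBuildingSet 𝒢) {U : X.Opens} (hU : IsBuildingSetOn 𝒢 U) (hsub : 𝒢' ⊆ 𝒢)
    (hlow : ∀ A ∈ 𝒢, ∀ B ∈ 𝒢', A ⊆ B → A ∈ 𝒢') : IsBuildingSetOn 𝒢' U := by
  -- By irreducibility the restriction of `𝒢'` is closed downwards as well.
  have hlow' : ∀ A ∈ restrict 𝒢 U, ∀ B ∈ 𝒢', A ⊆ B → A ∈ restrict 𝒢' U := by
    rintro _ ⟨hne, A, hA, rfl⟩ B hB hAB
    exact ⟨hne, A, hlow A hA B hB (h.subset_of_inter_subset hA (h.closed B (hsub hB)) hne hAB), rfl⟩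
  have hsub' : restrict 𝒢' U ⊆ restrict 𝒢 U := fun A ⟨hne, B, hB, hAB⟩ => ⟨hne, B, hsub hB, hAB⟩
  have hnot : ∀ S ⊆ 𝒢', S.Nonempty → ⋂₀ S ∩ (U : Set X) ∉ restrict 𝒢' U →
      ⋂₀ S ∩ (U : Set X) ∉ restrict 𝒢 U := by
    rintro S hS ⟨G, hG⟩ h1 h2
    exact h1 (hlow' _ h2 G (hS hG) (Set.inter_subset_left.trans (Set.sInter_subset_of_mem hG)))
  have hfac : ∀ L, factors (restrict 𝒢' U) L ⊆ factors (restrict 𝒢 U) L := by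
    intro L F hF
    refine ⟨⟨hsub' (factors_subset hF), subset_of_mem_factors hF⟩, fun F' hF' hle => ?_⟩
    obtain ⟨hne, K, hK, rfl⟩ := factors_subset hF
    exact (mem_factors.1 hF).le_of_le
      ⟨hlow' F' hF'.1 K hK (hle.trans Set.inter_subset_left), hF'.2⟩ hle
  have hint : ∀ S ⊆ 𝒢', S.Nonempty → (⋂₀ S ∩ (U : Set X)).Nonempty →
      ⋂₀ factors (restrict 𝒢' U) (⋂₀ S ∩ (U : Set X)) = ⋂₀ S ∩ U := by
    intro S hS hSne hne
    refine subset_antisymm (fun x hx => ?_) (Set.subset_sInter fun F hF => subset_of_mem_factors hF)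
    have : ∀ G ∈ S, x ∈ G ∩ (U : Set X) := by
      intro G hG
      have hle : ⋂₀ S ∩ (U : Set X) ⊆ G ∩ U :=
        Set.inter_subset_inter_left _ (Set.sInter_subset_of_mem hG)
      obtain ⟨F, hF, hFG⟩ := exists_factor_subset (restrict_finite (h.finite.subset hsub) U)
        ⟨hne.mono hle, G, hS hG, rfl⟩ hle
      exact hFG (hx F hF)
    obtain ⟨G, hG⟩ := hSne
    exact ⟨fun K hK => (this K hK).1, (this G hG).2⟩
  refine ⟨?_, ?_, ?_, ?_, ?_, ?_⟩
  · exact fun S hS => hU.preconnected S (hS.trans hsub)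
  · exact fun S hS => hU.nonsingular S (hS.trans hsub)
  · exact fun A hA => hU.proper A (hsub hA)
  · exact fun S hS h1 h2 T hT => hU.clean S (hS.trans hsub) h1 h2 T (hT.trans hsub)
  · intro S hS hSne hne hn y hy hyc
    have hn' := hnot S hS hSne hn
    have h1 := hU.transversal S (hS.trans hsub) hSne hne hn' y
      (by rwa [hU.inter S (hS.trans hsub) hSne hne hn', ← hint S hS hSne hne]) hyc
    exact iSupIndep_of_subset (t := fun A => (tangentAt A y).dualCoannihilator) (hfac _) h1
  · exact fun S hS hSne hne _ => hint S hS hSne hne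

/-- Well connectedness passes to `𝒢'` because a component of an intersection of members of `𝒢'` that
belongs to `𝒢` is contained in a member of `𝒢'`. -/
theorem IsWellConnectedBuildingSet.mono [IsNoetherian X] [JacobsonSpace X] {𝒢 𝒢' : Set (Set X)}
    (h : IsWellConnectedBuildingSet 𝒢) (hsub : 𝒢' ⊆ 𝒢)
    (hlow : ∀ A ∈ 𝒢, ∀ B ∈ 𝒢', A ⊆ B → A ∈ 𝒢') : IsWellConnectedBuildingSet 𝒢' := by
  have hb := h.isBuildingSet
  have hind : inducedArrangement 𝒢' ⊆ inducedArrangement 𝒢 :=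
    fun C ⟨S, hS, h1, h2⟩ => ⟨S, hS.trans hsub, h1, h2⟩
  refine ⟨IsBuildingSet.of_cover (hb.arrangement.finite.subset hind)
    (fun A hA => hb.closed A (hsub hA)) (fun A hA => hb.connected A (hsub hA))
    (fun A hA => (hb.arrangement.subvariety A (hind hA)).nonsingular) (fun A hA => ?_)
    (fun A hA B hB => hb.arrangement.clean A (hind hA) B (hind hB)) ?_, ?_⟩
  · have := (hb.arrangement.subvariety A (hb.building.subset (hsub hA))).proper.ne
    simpa using this
  · obtain ⟨𝒰, hcov, hU⟩ := hb.exists_cover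
    exact ⟨𝒰, hcov, fun U hUU => (hU U hUU).mono hb hsub hlow⟩
  · rintro S hS ⟨G, hG⟩
    refine (h.wellConnected S (hS.trans hsub) ⟨G, hG⟩).imp_right (Or.imp_right fun hC C hCS => ?_)
    exact hlow C (hC hCS) G (hS hG)
      ((subset_of_mem_components hCS).trans (Set.sInter_subset_of_mem hG))

end BuildingSets

/-! ### Independence in a modular lattice -/

/-- Let the `a B` be independent modulo `q`, and let `z` be below one of them. Then the `a B ⊔ z`
are independent modulo `z ⊔ q`. For ideals, `z` is the ideal of a subvariety and `q` is `𝔪²`. -/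
theorem inf_sup_le_of_independent {α β : Type*} [CompleteLattice α] [IsModularLattice α]
    {a : β → α} {S : Set β} {q z : α}
    (h : ∀ A ∈ S, (a A ⊔ q) ⊓ ((⨆ B ∈ S \ {A}, a B) ⊔ q) ≤ q) {E : β} (hE : E ∈ S)
    (hz : z ≤ a E) {A : β} (hA : A ∈ S) :
    (a A ⊔ z ⊔ q) ⊓ ((⨆ B ∈ S \ {A}, a B) ⊔ z ⊔ q) ≤ z ⊔ q := by
  by_cases hAE : A = E
  · subst hAE
    rw [sup_eq_left.2 hz, sup_right_comm, inf_comm, sup_comm _ z,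
      sup_inf_assoc_of_le _ (hz.trans le_sup_left), inf_comm]
    exact sup_le_sup_left (h A hA) z
  · have hzt : z ≤ (⨆ B ∈ S \ {A}, a B) ⊔ q :=
      (hz.trans (le_iSup₂ (f := fun B (_ : B ∈ S \ {A}) => a B) E ⟨hE, Ne.symm hAE⟩)).trans
        le_sup_left
    rw [show (⨆ B ∈ S \ {A}, a B) ⊔ z ⊔ q = (⨆ B ∈ S \ {A}, a B) ⊔ q by
      rw [sup_right_comm, sup_eq_left.2 hzt], sup_right_comm, sup_comm _ z,
      sup_inf_assoc_of_le _ hzt]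
    exact sup_le_sup_left (h A hA) z

/-! ### Traces of a building set on a maximal member -/

section Traces

variable {X : Scheme.{u}}

theorem idealAt_inter_open (A : Set X) (U : X.Opens) {y : X} (hy : y ∈ U) :
    idealAt (A ∩ U) y = idealAt A y := by
  refine le_antisymm ?_ (idealAt_anti Set.inter_subset_left y)
  rintro _ ⟨V, hV, s, hs, rfl⟩
  refine ⟨V ⊓ U, ⟨hV, hy⟩, X.presheaf.map (homOfLE inf_le_left).op s, fun x hx hA => ?_,
    TopCat.Presheaf.germ_res_apply ..⟩
  rw [Scheme.evaluation_eq_zero_iff_notMem_basicOpen, Scheme.basicOpen_res]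
  exact fun hxs => vanishesOn_iff.1 hs x ⟨hA, hx.2⟩ hxs.2

theorem image_trace (Z : Closeds X) (A : Set X) : inclusion Z '' trace Z A = A ∩ Z := by
  rw [trace, Set.image_preimage_eq_inter_range, range_inclusion]

theorem isInducing_inclusion (Z : Closeds X) : Topology.IsInducing (inclusion Z) :=
  (inclusion Z).isEmbedding.isInducing

theorem inclusion_injective (Z : Closeds X) : Function.Injective (inclusion Z) :=
  (inclusion Z).isEmbedding.injective

theorem inclusion_mem (Z : Closeds X) (y : asVariety Z) : inclusion Z y ∈ Z :=
  (range_inclusion Z).subset ⟨y, rfl⟩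

theorem trace_image (Z : Closeds X) (B : Set (asVariety Z)) : trace Z (inclusion Z '' B) = B :=
  Set.preimage_image_eq B (inclusion_injective Z)

theorem image_inter_preimage_opens (Z : Closeds X) (B : Set (asVariety Z)) (U : X.Opens) :
    inclusion Z '' (B ∩ ((inclusion Z ⁻¹ᵁ U : (asVariety Z).Opens) : Set (asVariety Z))) =
      inclusion Z '' B ∩ U :=
  Set.image_inter_preimage ..

theorem isConnected_of_image {Z : Closeds X} {B : Set (asVariety Z)}
    (h : _root_.IsConnected (inclusion Z '' B)) : _root_.IsConnected B :=
  ⟨Set.image_nonempty.1 h.nonempty,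
    (isInducing_inclusion Z).isPreconnected_image.1 h.isPreconnected⟩

/-- The connected components, in the variety `Z`, of the intersections `A ∩ Z` for the members `A`
of `𝒢` other than `Z`. -/
def traces (𝒢 : Set (Set X)) (Z : Closeds X) : Set (Set (asVariety Z)) :=
  {H | ∃ A ∈ 𝒢, A ≠ Z ∧ H ∈ components (trace Z A)}

variable {𝒢 : Set (Set X)} {Z : Closeds X}

/-- An intersection of traces on `Z` is an intersection of members of `𝒢`, as `Z` belongs to `𝒢`. -/
theorem exists_image_sInter_eq (hZ : (Z : Set X) ∈ 𝒢) {S : Set (Set (asVariety Z))}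
    (hS : ∀ H ∈ S, ∃ A ∈ 𝒢, A ≠ Z ∧ H = trace Z A) :
    ∃ T ⊆ 𝒢, T.Nonempty ∧ inclusion Z '' ⋂₀ S = ⋂₀ T := by
  refine ⟨insert (Z : Set X) {A ∈ 𝒢 | trace Z A ∈ S}, ?_, Set.insert_nonempty _ _, ?_⟩
  · exact Set.insert_subset hZ (Set.sep_subset _ _)
  · rw [Set.sInter_insert]
    ext x
    constructor
    · rintro ⟨y, hy, rfl⟩
      exact ⟨inclusion_mem Z y, fun A hA => hy _ hA.2⟩
    · rintro ⟨hxZ, hx⟩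
      obtain ⟨y, rfl⟩ := (range_inclusion Z).symm.subset hxZ
      refine ⟨y, fun H hH => ?_, rfl⟩
      obtain ⟨A, hA, -, rfl⟩ := hS H hH
      exact hx A ⟨hA, hH⟩

variable (h : IsWellConnectedBuildingSet 𝒢) (hZ : (Z : Set X) ∈ 𝒢)
  (hmax : ∀ A ∈ 𝒢, (Z : Set X) ⊆ A → A = Z)
include h hZ

omit hZ in
theorem trace_mem_traces_of_subset {A : Set X} (hA : A ∈ 𝒢) (hAZ : A ≠ Z) (hsub : A ⊆ Z) :
    trace Z A ∈ traces 𝒢 Z := by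
  refine ⟨A, hA, hAZ, mem_components_self (isConnected_of_image ?_)⟩
  rw [image_trace, Set.inter_eq_left.2 hsub]
  exact h.isBuildingSet.connected A hA

include hmax in
/-- By well connectedness: if `A ∩ Z` is not connected, its components belong to `𝒢`, and each of
them is its own trace. -/
theorem eq_trace_of_mem_traces {H : Set (asVariety Z)} (hH : H ∈ traces 𝒢 Z) :
    ∃ A ∈ 𝒢, A ≠ Z ∧ H = trace Z A := by
  obtain ⟨A, hA, hAZ, hHA⟩ := hH
  have hinter : ⋂₀ {A, (Z : Set X)} = inclusion Z '' trace Z A := by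
    rw [image_trace, Set.sInter_pair]
  have hne := (isConnected_of_mem_components hHA).nonempty.mono (subset_of_mem_components hHA)
  rcases h.wellConnected {A, (Z : Set X)} (Set.pair_subset hA hZ) (Set.insert_nonempty _ _) with
    h1 | h1 | h1
  · rw [hinter, Set.image_eq_empty] at h1
    exact absurd h1 hne.ne_empty
  · rw [hinter] at h1
    exact ⟨A, hA, hAZ, eq_of_mem_components hHA (isConnected_of_image h1).isPreconnected⟩
  · rw [hinter] at h1
    refine ⟨_, h1 (image_mem_components (isInducing_inclusion Z) hHA), fun hHZ => hAZ ?_,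
      (trace_image Z H).symm⟩
    refine hmax A hA ?_
    rw [← hHZ]
    exact (Set.image_mono (subset_of_mem_components hHA)).trans
      ((image_trace Z A).subset.trans Set.inter_subset_left)

include hmax in
theorem exists_image_sInter_eq_of_subset_traces {S : Set (Set (asVariety Z))}
    (hS : S ⊆ traces 𝒢 Z) : ∃ T ⊆ 𝒢, T.Nonempty ∧ inclusion Z '' ⋂₀ S = ⋂₀ T :=
  exists_image_sInter_eq hZ fun _ hH => eq_trace_of_mem_traces h hZ hmax (hS hH)

include hmax in
theorem image_mem_inducedArrangement {C : Set (asVariety Z)}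
    (hC : C ∈ inducedArrangement (traces 𝒢 Z)) : inclusion Z '' C ∈ inducedArrangement 𝒢 := by
  obtain ⟨S, hS, -, hCS⟩ := hC
  obtain ⟨T, hT, hTne, hST⟩ := exists_image_sInter_eq_of_subset_traces h hZ hmax hS
  exact ⟨T, hT, hTne, hST ▸ image_mem_components (isInducing_inclusion Z) hCS⟩

include hmax in
theorem ne_univ_of_mem_traces {H : Set (asVariety Z)} (hH : H ∈ traces 𝒢 Z) : H ≠ Set.univ := by
  obtain ⟨A, hA, hAZ, rfl⟩ := eq_trace_of_mem_traces h hZ hmax hH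
  intro huniv
  refine hAZ (hmax A hA ?_)
  rw [← Set.inter_eq_right, ← image_trace, huniv, Set.image_univ, range_inclusion]

omit h in
/-- Over `U` the intersection `A ∩ Z` is connected, so it is the restriction of a single component
of `A ∩ Z`. -/
theorem trace_inter_mem_restrict {U : X.Opens} (hU : IsBuildingSetOn 𝒢 U) {A : Set X}
    (hA : A ∈ 𝒢) (hAZ : A ≠ Z) (hne : (A ∩ Z ∩ (U : Set X)).Nonempty) :
    trace Z A ∩ ((inclusion Z ⁻¹ᵁ U : (asVariety Z).Opens) : Set (asVariety Z)) ∈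
      restrict (traces 𝒢 Z) (inclusion Z ⁻¹ᵁ U) := by
  have himage := image_inter_preimage_opens Z (trace Z A) U
  rw [image_trace] at himage
  have hne' : (trace Z A ∩
      ((inclusion Z ⁻¹ᵁ U : (asVariety Z).Opens) : Set (asVariety Z))).Nonempty := by
    rw [← Set.image_nonempty, himage]; exact hne
  have hpre : IsPreconnected
      (trace Z A ∩ ((inclusion Z ⁻¹ᵁ U : (asVariety Z).Opens) : Set (asVariety Z))) := by
    rw [← (isInducing_inclusion Z).isPreconnected_image, himage]
    have := hU.preconnected {A, (Z : Set X)} (Set.pair_subset hA hZ) (Set.insert_nonempty _ _)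
    rw [Set.sInter_pair] at this
    exact this hne
  obtain ⟨y, hyA, hyU⟩ := hne'
  have hC : connectedComponentIn (trace Z A) y ∈ components (trace Z A) := ⟨y, hyA, rfl⟩
  refine ⟨⟨y, hyA, hyU⟩, _, ⟨A, hA, hAZ, hC⟩, ?_⟩
  exact (inter_eq_of_mem_components hC hpre ⟨y, mem_connectedComponentIn hyA, hyU⟩).symm

include hmax in
theorem traces_finite : (traces 𝒢 Z).Finite := by
  refine (h.isBuildingSet.finite.image (trace Z)).subset fun H hH => ?_
  obtain ⟨A, hA, -, rfl⟩ := eq_trace_of_mem_traces h hZ hmax hH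
  exact ⟨A, hA, rfl⟩

include hmax in
theorem sInter_factors_traces {U : X.Opens} (hU : IsBuildingSetOn 𝒢 U)
    {L H : Set (asVariety Z)} (hL : L.Nonempty) (hH : H ∈ restrict (traces 𝒢 Z) (inclusion Z ⁻¹ᵁ U))
    (hLH : L ⊆ H) (hint : ⋂₀ factors (restrict 𝒢 U) (inclusion Z '' L) = inclusion Z '' L) :
    ⋂₀ factors (restrict (traces 𝒢 Z) (inclusion Z ⁻¹ᵁ U)) L = L := by
  have hfin := restrict_finite (traces_finite h hZ hmax) (inclusion Z ⁻¹ᵁ U)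
  refine subset_antisymm (fun x hx => ?_) (Set.subset_sInter fun F hF => subset_of_mem_factors hF)
  rw [← (inclusion_injective Z).mem_set_image, ← hint]
  intro E hE
  have hLE := subset_of_mem_factors hE
  obtain ⟨hEne, B, hB, rfl⟩ := factors_subset hE
  by_cases hBZ : B = Z
  · obtain ⟨F, hF, hFH⟩ := exists_factor_subset hfin hH hLH
    obtain ⟨-, K, -, rfl⟩ := hH
    exact ⟨hBZ ▸ inclusion_mem Z x, (hFH (hx F hF)).2⟩
  · have hLB : inclusion Z '' L ⊆ B ∩ Z ∩ U := by
      rintro _ ⟨y, hy, rfl⟩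
      have := hLE ⟨y, hy, rfl⟩
      exact ⟨⟨this.1, inclusion_mem Z y⟩, this.2⟩
    have hmem := trace_inter_mem_restrict hZ hU hB hBZ ((hL.image _).mono hLB)
    have hBim := image_inter_preimage_opens Z (trace Z B) U
    rw [image_trace] at hBim
    obtain ⟨F, hF, hFB⟩ := exists_factor_subset (L := L) hfin hmem (by
      rw [← Set.image_subset_image_iff (inclusion_injective Z), hBim]
      exact hLB)
    exact hFB (hx F hF)

variable [IsNoetherian X] [JacobsonSpace X]

include hmax in
/-- If a proper intersection of traces is a member of `𝒢` over `U`, then it is a member of the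
traced family: the member of `𝒢` is contained in `Z` and differs from `Z`. -/
theorem notMem_restrict_of_image {U : X.Opens} (hU : IsBuildingSetOn 𝒢 U)
    {L : Set (asVariety Z)} (hL : L ∉ restrict (traces 𝒢 Z) (inclusion Z ⁻¹ᵁ U))
    {H : Set (asVariety Z)} (hH : H ∈ traces 𝒢 Z) (hLH : L ⊆ H) :
    inclusion Z '' L ∉ restrict 𝒢 U := by
  rintro ⟨hne, A, hA, hLA⟩
  have hAU : (A ∩ (U : Set X)).Nonempty := hLA ▸ hne
  have hsubZ : A ∩ (U : Set X) ⊆ Z := by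
    rw [← hLA]
    rintro _ ⟨y, -, rfl⟩
    exact inclusion_mem Z y
  have hAsub : A ⊆ Z := h.isBuildingSet.subset_of_inter_subset hA Z.2 hAU hsubZ
  have hAZ : A ≠ Z := by
    rintro rfl
    obtain ⟨B, hB, hBZ, rfl⟩ := eq_trace_of_mem_traces h hZ hmax hH
    refine hBZ (hmax B hB (h.isBuildingSet.subset_of_inter_subset hZ
      (h.isBuildingSet.closed B hB) hAU ?_))
    rw [← hLA]
    rintro _ ⟨y, hy, rfl⟩
    exact hLH hy
  apply hL
  have h1 := trace_inter_mem_restrict hZ hU hA hAZ (by rwa [Set.inter_eq_left.2 hAsub])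
  convert h1
  apply (inclusion_injective Z).image_injective
  rw [image_inter_preimage_opens, image_trace, hLA, Set.inter_eq_left.2 hAsub]

include hmax in
/-- Each factor of `L` in the traced family is the trace of a factor of `L` in `𝒢`. -/
theorem exists_factor_image_eq {U : X.Opens} (hU : IsBuildingSetOn 𝒢 U)
    {L F : Set (asVariety Z)} (hL : L.Nonempty)
    (hF : F ∈ factors (restrict (traces 𝒢 Z) (inclusion Z ⁻¹ᵁ U)) L) :
    ∃ E ∈ factors (restrict 𝒢 U) (inclusion Z '' L), inclusion Z '' F = E ∩ Z := by
  obtain ⟨hFne, H, hH, hFH⟩ := factors_subset hF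
  obtain ⟨A, hA, hAZ, rfl⟩ := eq_trace_of_mem_traces h hZ hmax hH
  have hFim : inclusion Z '' F = A ∩ Z ∩ U := by
    rw [hFH, image_inter_preimage_opens, image_trace]
  have hLF : inclusion Z '' L ⊆ A ∩ Z ∩ U := hFim ▸ Set.image_mono (subset_of_mem_factors hF)
  have hLA : inclusion Z '' L ⊆ A ∩ U :=
    hLF.trans (Set.inter_subset_inter_left _ Set.inter_subset_left)
  obtain ⟨E, hE, hEA⟩ := exists_factor_subset (restrict_finite h.isBuildingSet.finite U)
    ⟨(hL.image _).mono hLA, A, hA, rfl⟩ hLA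
  refine ⟨E, hE, ?_⟩
  have hLE := subset_of_mem_factors hE
  obtain ⟨hEne, B, hB, rfl⟩ := factors_subset hE
  have hBZ : B ≠ Z := by
    rintro rfl
    exact hAZ (hmax A hA (h.isBuildingSet.subset_of_inter_subset hZ
      (h.isBuildingSet.closed A hA) hEne (hEA.trans Set.inter_subset_left)))
  have hLB : inclusion Z '' L ⊆ B ∩ Z ∩ U := fun x hx =>
    ⟨⟨(hLE hx).1, (hLF hx).1.2⟩, (hLF hx).2⟩
  have hmem := trace_inter_mem_restrict hZ hU hB hBZ ((hL.image _).mono hLB)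
  have hBim := image_inter_preimage_opens Z (trace Z B) U
  rw [image_trace] at hBim
  have h1 := (mem_factors.1 hF).eq_of_le (y := trace Z B ∩ _) ⟨hmem, ?_⟩ ?_
  · rw [← h1, hBim, Set.inter_right_comm]
  · rw [← Set.image_subset_image_iff (inclusion_injective Z), hBim]
    exact hLB
  · refine (Set.image_subset_image_iff (inclusion_injective Z)).1 ?_
    rw [hBim, hFim]
    exact fun x hx => ⟨⟨(hEA ⟨hx.1.1, hx.2⟩).1, hx.1.2⟩, hx.2⟩

include hmax in
/-- The ideals of the factors in the traced family are the images, in the local ring of `Z`, of the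
ideals of factors in `𝒢`. One factor of `L` in `𝒢` is contained in `Z`, so
`inf_sup_le_of_independent` applies. -/
theorem intersectTransversally_factors_traces {U : X.Opens} (hU : IsBuildingSetOn 𝒢 U)
    {L : Set (asVariety Z)} (hL : L.Nonempty)
    (hLF : ⋂₀ factors (restrict (traces 𝒢 Z) (inclusion Z ⁻¹ᵁ U)) L = L)
    (hLU : inclusion Z '' L ⊆ U)
    (hint : ⋂₀ factors (restrict 𝒢 U) (inclusion Z '' L) = inclusion Z '' L)
    (htrans : IntersectTransversally (factors (restrict 𝒢 U) (inclusion Z '' L))) :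
    IntersectTransversally (factors (restrict (traces 𝒢 Z) (inclusion Z ⁻¹ᵁ U)) L) := by
  intro y hyF hy
  have hyL : y ∈ L := hLF ▸ hyF
  have hyU : inclusion Z y ∈ U := hLU ⟨y, hyL, rfl⟩
  have hyE : inclusion Z y ∈ ⋂₀ factors (restrict 𝒢 U) (inclusion Z '' L) :=
    hint.symm ▸ ⟨y, hyL, rfl⟩
  -- Transversality in `X`, to be reduced modulo `z`.
  have hX := (iSupIndep_dualCoannihilator_tangentAt_iff hyE).1
    (htrans _ hyE (isClosed_singleton_image _ hy))
  rw [iSupIndep_dualCoannihilator_tangentAt_iff hyF]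
  set q := maximalIdeal (X.presheaf.stalk (inclusion Z y)) ^ 2 with hq
  set φ := ((inclusion Z).stalkMap y).hom with hφ
  have hφs : Function.Surjective φ := (inclusion Z).stalkMap_surjective y
  set z := idealAt (Z : Set X) (inclusion Z y) with hz
  have hker : Ideal.comap φ ⊥ = z := ker_stalkMap_inclusion Z y
  have hZU : ((Z : Set X) ∩ U).Nonempty := ⟨_, inclusion_mem Z y, hyU⟩
  obtain ⟨E₀, hE₀, hE₀Z⟩ := exists_factor_subset (L := inclusion Z '' L)
    (restrict_finite h.isBuildingSet.finite U) ⟨hZU, Z, hZ, rfl⟩ (by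
      rintro _ ⟨x, hx, rfl⟩
      exact ⟨inclusion_mem Z x, hLU ⟨x, hx, rfl⟩⟩)
  have hzE₀ : z ≤ idealAt E₀ (inclusion Z y) :=
    idealAt_anti (hE₀Z.trans Set.inter_subset_left) _
  -- Cleanness makes the ideal of a trace, modulo `𝔪²`, the sum of the two ideals.
  have hclean : ∀ E ∈ factors (restrict 𝒢 U) (inclusion Z '' L),
      idealAt (E ∩ Z) (inclusion Z y) ⊔ q = idealAt E (inclusion Z y) ⊔ z ⊔ q := by
    intro E hE
    have hyE' := hyE E hE
    obtain ⟨hEne, B, hB, rfl⟩ := factors_subset hE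
    have h1 := (hU.intersectCleanly hB hZ hEne hZU).idealAt_inter_sup hyE'
      ⟨inclusion_mem Z y, hyU⟩ (isClosed_singleton_image _ hy)
    rw [idealAt_inter_open (Z : Set X) U hyU] at h1
    rw [← h1]
    congr 2
    ext x
    simp only [Set.mem_inter_iff]
    tauto
  choose! E hE hFE using fun F hF => exists_factor_image_eq h hZ hmax hU (L := L) (F := F) hL hF
  intro F hF
  set Φ := factors (restrict (traces 𝒢 Z) (inclusion Z ⁻¹ᵁ U)) L with hΦ
  have hmapF : ∀ K ∈ Φ, idealAt K y = (idealAt (E K ∩ Z) (inclusion Z y)).map φ := by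
    intro K hK
    rw [idealAt_eq_map (inclusion Z) K y, hFE K hK]
  have hle : (⨆ K ∈ Φ \ {F}, idealAt K y) ≤
      (⨆ D ∈ factors (restrict 𝒢 U) (inclusion Z '' L) \ {E F},
        idealAt D (inclusion Z y) ⊔ z ⊔ q).map φ := by
    refine iSup₂_le fun K hK => ?_
    rw [hmapF K hK.1]
    refine Ideal.map_mono (le_sup_left.trans ((hclean _ (hE K hK.1)).le.trans ?_))
    refine le_iSup₂ (f := fun D (_ : D ∈ factors (restrict 𝒢 U) (inclusion Z '' L) \ {E F}) =>
      idealAt D (inclusion Z y) ⊔ z ⊔ q) (E K) ⟨hE K hK.1, fun hEK => hK.2 ?_⟩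
    apply (inclusion_injective Z).image_injective
    rw [hFE K hK.1, hFE F hF, hEK]
  have hn : maximalIdeal ((asVariety Z).presheaf.stalk y) ^ 2 = q.map φ := by
    rw [hq, Ideal.map_pow, map_maximalIdeal_stalkMap]
  have hab := inf_sup_le_of_independent hX hE₀ hzE₀ (hE F hF)
  rintro x ⟨hx1, hx2⟩
  obtain ⟨r, rfl⟩ := hφs x
  -- Membership in ideals of the local ring of `Z` lifts, because `z` is the kernel of `φ`.
  have hmem : ∀ {a : Ideal (X.presheaf.stalk (inclusion Z y))}, z ≤ a → φ r ∈ a.map φ → r ∈ a := by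
    intro a hza hr
    rw [← Ideal.mem_comap, Ideal.comap_map_of_surjective φ hφs, hker, sup_eq_left.2 hza] at hr
    exact hr
  have h1 : r ∈ idealAt (E F) (inclusion Z y) ⊔ z ⊔ q := by
    refine hmem (le_sup_right.trans le_sup_left) ?_
    rw [← hclean _ (hE F hF), Ideal.map_sup, ← hn, ← hmapF F hF]
    exact hx1
  have h2 : r ∈ (⨆ D ∈ factors (restrict 𝒢 U) (inclusion Z '' L) \ {E F},
      idealAt D (inclusion Z y)) ⊔ z ⊔ q := by
    refine hmem (le_sup_right.trans le_sup_left) ?_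
    have h3 : (⨆ K ∈ Φ \ {F}, idealAt K y) ⊔ q.map φ ≤
        ((⨆ D ∈ factors (restrict 𝒢 U) (inclusion Z '' L) \ {E F},
          idealAt D (inclusion Z y)) ⊔ z ⊔ q).map φ := by
      refine sup_le (hle.trans (Ideal.map_mono (iSup₂_le fun D hD => ?_)))
        (Ideal.map_mono le_sup_right)
      exact sup_le_sup_right (sup_le_sup_right (le_iSup₂ (f := fun D (_ : D ∈
        factors (restrict 𝒢 U) (inclusion Z '' L) \ {E F}) => idealAt D (inclusion Z y)) D hD) _) _
    exact h3 (hn ▸ hx2)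
  obtain ⟨b, hb, c, hc, hbc⟩ := Submodule.mem_sup.1 (hab ⟨h1, h2⟩)
  rw [← hbc, map_add, show φ b = 0 from (hker.symm ▸ hb : b ∈ Ideal.comap φ ⊥), zero_add, hn]
  exact Ideal.mem_map_of_mem φ hc

include hmax in
theorem isBuildingSetOn_traces {U : X.Opens} (hU : IsBuildingSetOn 𝒢 U) :
    IsBuildingSetOn (traces 𝒢 Z) (inclusion Z ⁻¹ᵁ U) := by
  have key : ∀ S ⊆ traces 𝒢 Z, (⋂₀ S ∩ ((inclusion Z ⁻¹ᵁ U : (asVariety Z).Opens) :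
      Set (asVariety Z))).Nonempty → ∃ T ⊆ 𝒢, T.Nonempty ∧ (⋂₀ T ∩ (U : Set X)).Nonempty ∧
      inclusion Z '' (⋂₀ S ∩ ((inclusion Z ⁻¹ᵁ U : (asVariety Z).Opens) : Set (asVariety Z))) =
        ⋂₀ T ∩ U := by
    intro S hS hne
    obtain ⟨T, hT, hTne, hST⟩ := exists_image_sInter_eq_of_subset_traces h hZ hmax hS
    have h1 := image_inter_preimage_opens Z (⋂₀ S) U
    rw [hST] at h1
    exact ⟨T, hT, hTne, h1 ▸ hne.image _, h1⟩
  have hfac : ∀ S ⊆ traces 𝒢 Z, S.Nonempty → ∀ L : Set (asVariety Z), L = ⋂₀ S ∩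
      ((inclusion Z ⁻¹ᵁ U : (asVariety Z).Opens) : Set (asVariety Z)) → L.Nonempty →
      L ∉ restrict (traces 𝒢 Z) (inclusion Z ⁻¹ᵁ U) →
      ⋂₀ factors (restrict (traces 𝒢 Z) (inclusion Z ⁻¹ᵁ U)) L = L ∧
        IntersectTransversally (factors (restrict (traces 𝒢 Z) (inclusion Z ⁻¹ᵁ U)) L) := by
    rintro S hS ⟨H, hH⟩ _ rfl hne hn
    obtain ⟨T, hT, hTne, hT', hST⟩ := key S hS hne
    have hle := Set.inter_subset_inter_left
      ((inclusion Z ⁻¹ᵁ U : (asVariety Z).Opens) : Set (asVariety Z)) (Set.sInter_subset_of_mem hH)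
    have hnX := notMem_restrict_of_image h hZ hmax hU hn (hS hH)
      (hle.trans Set.inter_subset_left)
    rw [hST] at hnX
    have hint := hU.inter T hT hTne hT' hnX
    have htrans := hU.transversal T hT hTne hT' hnX
    rw [← hST] at hint htrans
    have h1 := sInter_factors_traces h hZ hmax hU hne ⟨hne.mono hle, H, hS hH, rfl⟩ hle hint
    exact ⟨h1, intersectTransversally_factors_traces h hZ hmax hU hne h1
      (hST.subset.trans Set.inter_subset_right) hint htrans⟩
  refine ⟨?_, ?_, ?_, ?_, ?_, ?_⟩
  · intro S hS _ hne
    obtain ⟨T, hT, hTne, hT', hST⟩ := key S hS hne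
    rw [← (isInducing_inclusion Z).isPreconnected_image, hST]
    exact hU.preconnected T hT hTne hT'
  · intro S hS _ hne
    obtain ⟨T, hT, hTne, hT', hST⟩ := key S hS hne
    refine IsNonsingularSubset.of_image (f := inclusion Z) ?_
    rw [hST]
    exact hU.nonsingular T hT hTne hT'
  · intro H hH hne heq
    obtain ⟨A, hA, hAZ, rfl⟩ := eq_trace_of_mem_traces h hZ hmax hH
    obtain ⟨y, -, hyU⟩ := hne
    refine hAZ (hmax A hA (h.isBuildingSet.subset_of_inter_subset hZ (h.isBuildingSet.closed A hA)
      ⟨_, inclusion_mem Z y, hyU⟩ ?_))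
    rintro x ⟨hxZ, hxU⟩
    obtain ⟨w, rfl⟩ := (range_inclusion Z).symm.subset hxZ
    have hw : w ∈ ((inclusion Z ⁻¹ᵁ U : (asVariety Z).Opens) : Set (asVariety Z)) := hxU
    rw [← heq] at hw
    exact hw.1
  · intro S hS _ hne S' hS' _ hne'
    obtain ⟨T, hT, hTne, hT', hST⟩ := key S hS hne
    obtain ⟨T₂, hT₂, hTne₂, hT₂', hST₂⟩ := key S' hS' hne'
    refine IntersectCleanly.of_image (f := inclusion Z) ?_
    rw [hST, hST₂]
    exact hU.clean T hT hTne hT' T₂ hT₂ hTne₂ hT₂'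
  · exact fun S hS hSne hne hn => (hfac S hS hSne _ rfl hne hn).2
  · exact fun S hS hSne hne hn => (hfac S hS hSne _ rfl hne hn).1

include hmax in
/-- The open cover is the preimage of one for `𝒢`. For well connectedness, an intersection of traces
is an intersection of members of `𝒢`; if its components belong to `𝒢`, each of them is its own
trace. -/
theorem isWellConnectedBuildingSet_traces : IsWellConnectedBuildingSet (traces 𝒢 Z) := by
  have hb := h.isBuildingSet
  refine ⟨IsBuildingSet.of_cover ?_ ?_ ?_ ?_ ?_ ?_ ?_, ?_⟩
  · refine Set.Finite.of_finite_image (f := fun B => inclusion Z '' B)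
      (hb.arrangement.finite.subset ?_) (inclusion_injective Z).image_injective.injOn
    rintro _ ⟨C, hC, rfl⟩
    exact image_mem_inducedArrangement h hZ hmax hC
  · rintro H ⟨A, hA, -, hH⟩
    exact isClosed_of_mem_components ((hb.closed A hA).preimage (inclusion Z).continuous) hH
  · rintro H ⟨A, hA, -, hH⟩
    exact isConnected_of_mem_components hH
  · intro C hC
    exact IsNonsingularSubset.of_image (f := inclusion Z)
      (hb.arrangement.subvariety _ (image_mem_inducedArrangement h hZ hmax hC)).nonsingular
  · exact fun H hH => ne_univ_of_mem_traces h hZ hmax hH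
  · intro C hC D hD
    exact IntersectCleanly.of_image (f := inclusion Z) (hb.arrangement.clean _
      (image_mem_inducedArrangement h hZ hmax hC) _ (image_mem_inducedArrangement h hZ hmax hD))
  · obtain ⟨𝒰, hcov, hU⟩ := hb.exists_cover
    refine ⟨(fun U => inclusion Z ⁻¹ᵁ U) '' 𝒰, ?_, ?_⟩
    · rw [eq_top_iff]
      intro y _
      have : inclusion Z y ∈ sSup 𝒰 := hcov ▸ trivial
      obtain ⟨U, hUU, hyU⟩ := Opens.mem_sSup.1 this
      exact Opens.mem_sSup.2 ⟨_, ⟨U, hUU, rfl⟩, hyU⟩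
    · rintro _ ⟨U, hUU, rfl⟩
      exact isBuildingSetOn_traces h hZ hmax (hU U hUU)
  · rintro S hS ⟨H, hH⟩
    obtain ⟨T, hT, hTne, hST⟩ := exists_image_sInter_eq_of_subset_traces h hZ hmax hS
    rcases h.wellConnected T hT hTne with h1 | h1 | h1
    · left
      rwa [← hST, Set.image_eq_empty] at h1
    · right; left
      exact isConnected_of_image (hST ▸ h1)
    · right; right
      intro C hC
      have hCG : inclusion Z '' C ∈ 𝒢 :=
        h1 (hST ▸ image_mem_components (isInducing_inclusion Z) hC)
      rw [← trace_image Z C]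
      refine trace_mem_traces_of_subset h hCG (fun hCZ => ?_) ?_
      · refine ne_univ_of_mem_traces h hZ hmax (hS hH) (Set.univ_subset_iff.1 ?_)
        have hCu : C = Set.univ := by
          apply (inclusion_injective Z).image_injective
          rw [hCZ, Set.image_univ, range_inclusion]
        rw [← hCu]
        exact (subset_of_mem_components hC).trans (Set.sInter_subset_of_mem hH)
      · rintro _ ⟨y, -, rfl⟩
        exact inclusion_mem Z y

end Traces

/-! ### Inclusions between traces -/

/-- If `A ∩ Z ⊆ B`, then `A ⊆ B` unless `A` can be replaced by a smaller member with the same trace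
on `Z`. -/
theorem subset_or_exists_ssubset_of_inter_subset {X : Scheme.{u}} [IsNoetherian X]
    [JacobsonSpace X] {𝒢 : Set (Set X)} (h : IsBuildingSet 𝒢) {A B Z : Set X}
    (hA : A ∈ 𝒢) (hB : B ∈ 𝒢) (hZ : Z ∈ 𝒢) (hZB : ¬ Z ⊆ B) (hconn : _root_.IsConnected (A ∩ Z))
    (hAZB : A ∩ Z ⊆ B) : A ⊆ B ∨ ∃ K ∈ 𝒢, K ⊂ A ∧ K ∩ Z = A ∩ Z := by
  have hirr : IsIrreducible (A ∩ Z) := by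
    refine h.isIrreducible_of_mem_inducedArrangement ⟨{A, Z}, Set.pair_subset hA hZ,
      Set.insert_nonempty _ _, ?_⟩
    rw [Set.sInter_pair]
    exact mem_components_self hconn
  obtain ⟨𝒰, hcov, h𝒰⟩ := h.exists_cover
  obtain ⟨x, hxA, hxZ⟩ := hconn.nonempty
  obtain ⟨U, hUU, hxU⟩ := Opens.mem_sSup.1 (show x ∈ sSup 𝒰 from hcov ▸ trivial)
  have hU := h𝒰 U hUU
  have hAU : (A ∩ (U : Set X)).Nonempty := ⟨x, hxA, hxU⟩
  have hZU : (Z ∩ (U : Set X)).Nonempty := ⟨x, hxZ, hxU⟩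
  have hBU : (B ∩ (U : Set X)).Nonempty := ⟨x, hAZB ⟨hxA, hxZ⟩, hxU⟩
  have hLne : (A ∩ Z ∩ (U : Set X)).Nonempty := ⟨x, ⟨hxA, hxZ⟩, hxU⟩
  -- If `A ∩ Z` is a member over `U`, it is a member `K`, and either `K = A` or `K` replaces `A`.
  by_cases hL : A ∩ Z ∩ (U : Set X) ∈ restrict 𝒢 U
  · obtain ⟨-, K, hK, hLK⟩ := hL
    have hKU : (K ∩ (U : Set X)).Nonempty := hLK ▸ hLne
    have hsub : A ∩ Z ⊆ K := subset_of_inter_subset hirr.isPreirreducible (h.closed K hK) U.2 hLne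
      (hLK.subset.trans Set.inter_subset_left)
    have hsub' : K ⊆ A ∩ Z :=
      h.subset_of_inter_subset hK ((h.closed A hA).inter (h.closed Z hZ)) hKU
      (hLK.symm.subset.trans Set.inter_subset_left)
    have hKeq : K = A ∩ Z := subset_antisymm hsub' hsub
    by_cases hKA : K = A
    · exact Or.inl (hKA ▸ hKeq ▸ hAZB)
    · exact Or.inr ⟨K, hK, (hsub'.trans Set.inter_subset_left).ssubset_of_ne hKA, by
        rw [hKeq, Set.inter_assoc, Set.inter_self]⟩
  have htrans := hU.transversal {A, Z} (Set.pair_subset hA hZ) (Set.insert_nonempty _ _)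
    (by rwa [Set.sInter_pair]) (by rwa [Set.sInter_pair])
  have hint := hU.inter {A, Z} (Set.pair_subset hA hZ) (Set.insert_nonempty _ _)
    (by rwa [Set.sInter_pair]) (by rwa [Set.sInter_pair])
  rw [Set.sInter_pair] at htrans hint
  have hfin := restrict_finite h.finite U
  obtain ⟨F₁, hF₁, hF₁A⟩ := exists_factor_subset (L := A ∩ Z ∩ (U : Set X)) hfin ⟨hAU, A, hA, rfl⟩
    (Set.inter_subset_inter_left _ Set.inter_subset_left)
  obtain ⟨F₂, hF₂, hF₂Z⟩ := exists_factor_subset (L := A ∩ Z ∩ (U : Set X)) hfin ⟨hZU, Z, hZ, rfl⟩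
    (Set.inter_subset_inter_left _ Set.inter_subset_right)
  obtain ⟨F₃, hF₃, hF₃B⟩ := exists_factor_subset (L := A ∩ Z ∩ (U : Set X)) hfin ⟨hBU, B, hB, rfl⟩
    (Set.inter_subset_inter_left _ hAZB)
  have hLF₁ := subset_of_mem_factors hF₁
  obtain ⟨hKU, K, hK, rfl⟩ := factors_subset hF₁
  have hKA : K ⊆ A :=
    h.subset_of_inter_subset hK (h.closed A hA) hKU (hF₁A.trans Set.inter_subset_left)
  -- A factor properly contained in `A` replaces `A`.
  by_cases hKeq : K = A
  swap
  · refine Or.inr ⟨K, hK, hKA.ssubset_of_ne hKeq, subset_antisymm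
      (Set.inter_subset_inter_left _ hKA) (Set.subset_inter ?_ Set.inter_subset_right)⟩
    exact subset_of_inter_subset hirr.isPreirreducible (h.closed K hK) U.2 hLne
      (hLF₁.trans Set.inter_subset_left)
  subst hKeq
  left
  -- From here on `A = K` is a factor over `U`. If it is the one contained in `B`, then `A ⊆ B`.
  by_cases hF₃K : F₃ = K ∩ U
  · exact h.subset_of_inter_subset hA (h.closed B hB) hAU
      (hF₃K ▸ hF₃B.trans Set.inter_subset_left)
  have hF₂K : F₂ ≠ K ∩ U := by
    rintro rfl
    have hKZ : K ⊆ Z := h.subset_of_inter_subset hK (h.closed Z hZ) hKU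
      (hF₂Z.trans Set.inter_subset_left)
    exact hL ⟨hLne, K, hK, by rw [Set.inter_eq_left.2 hKZ]⟩
  obtain ⟨y, ⟨⟨hyK, hyZ⟩, hyU⟩, hy⟩ := nonempty_inter_closedPoints hLne
    (((h.closed K hK).inter (h.closed Z hZ)).isLocallyClosed.inter U.2.isLocallyClosed)
  have hyL : y ∈ ⋂₀ factors (restrict 𝒢 U) (K ∩ Z ∩ U) := hint.symm ▸ ⟨⟨hyK, hyZ⟩, hyU⟩
  have hX := (iSupIndep_dualCoannihilator_tangentAt_iff hyL).1 (htrans y hyL hy)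
  have hyB : y ∈ B ∩ (U : Set X) := ⟨hAZB ⟨hyK, hyZ⟩, hyU⟩
  set q := maximalIdeal (X.presheaf.stalk y) ^ 2 with hq
  set z := idealAt (Z ∩ (U : Set X)) y with hz
  set b := idealAt (B ∩ (U : Set X)) y with hb
  have hab := inf_sup_le_of_independent hX hF₂ (idealAt_anti hF₂Z y : z ≤ _) hF₁
  have hclean := hU.intersectCleanly hK hZ hKU hZU
  have hclean₁ := hclean.idealAt_inter_sup (Set.mem_inter hyK hyU) (Set.mem_inter hyZ hyU) hy
  -- The ideal of `B` lies in `I_{A ∩ Z}`, and also in the ideal of the factor `F₃`, which is not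
  -- `A`.
  have hble : b ≤ z ⊔ q := by
    refine le_trans (le_inf ?_ ?_) hab
    · rw [← hclean₁]
      exact (idealAt_anti
        (fun w hw => Set.mem_inter (hAZB (Set.mem_inter hw.1.1 hw.2.1)) hw.1.2) y).trans le_sup_left
    · refine (idealAt_anti hF₃B y).trans ?_
      exact (le_iSup₂ (f := fun D (_ : D ∈ factors (restrict 𝒢 U) (K ∩ Z ∩ (U : Set X)) \
        {K ∩ ↑U}) => idealAt D y) F₃ ⟨hF₃, hF₃K⟩).trans (le_sup_left.trans le_sup_left)
  have hcleanB := hU.intersectCleanly hB hZ hBU hZU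
  have hclean₂ := hcleanB.idealAt_inter_sup hyB (Set.mem_inter hyZ hyU) hy
  have hnsZ : IsNonsingularSubset (Z ∩ (U : Set X)) := by
    have := hU.nonsingular {Z} (by simpa using hZ) (Set.singleton_nonempty _) (by simpa using hZU)
    simpa using this
  -- `B ∩ Z` and `Z` are nonsingular with the same tangent space at `y`.
  have hle : idealAt (B ∩ U ∩ (Z ∩ (U : Set X))) y ≤ z := by
    refine le_of_isRegularLocalRing_quotient (idealAt_anti Set.inter_subset_right y)
      (hnsZ y ⟨hyZ, hyU⟩ hy) (hcleanB.1 y ⟨hyB, hyZ, hyU⟩ hy) ?_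
    refine le_sup_left.trans (hclean₂.le.trans ?_)
    exact sup_le (sup_le hble le_sup_left) le_sup_right
  obtain ⟨V, hyV, hV⟩ := exists_inter_subset_of_idealAt_le (h.closed B hB) (y := y)
    (A := Z ∩ (U : Set X)) ((idealAt_anti (fun w hw => hw.1.1) y).trans hle)
  refine absurd (h.subset_of_inter_subset (U := U ⊓ V) hZ (h.closed B hB) ⟨y, hyZ, hyU, hyV⟩ ?_) hZB
  exact fun w hw => hV ⟨⟨hw.1, hw.2.1⟩, hw.2.2⟩

end SubvarietyArrangement

open SubvarietyArrangement in
theorem mainTheorem4 (X : Scheme.{0}) (π : X ⟶ Spec (CommRingCat.of ℂ))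
    [IsSeparated π] [LocallyOfFiniteType π] [QuasiCompact π] (hX : IsNonsingular X)
    (n : ℕ) (G : Fin (n + 1) → Closeds X) (hinj : Function.Injective G)
    (hord : ∀ i j, G i < G j → i < j)
    (hG : IsWellConnectedBuildingSet (Set.range fun i => (G i : Set X))) :
    -- the traced family is a well connected building set in `Z`
    IsWellConnectedBuildingSet (tracedFamily G) ∧
    -- each of its members is of the form `G k ∩ Z`, so that the order on it below makes sense
    (∀ H ∈ tracedFamily G,
      ∃ k : Fin n, trace (G (Fin.last n)) (G k.castSucc : Set X) = H) ∧
    -- if it is listed by increasing minimal index `s i` with `H i = G (s i) ∩ Z`, then all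
    -- its initial segments are well connected building sets in `Z`
    (∀ (u : ℕ) (H : Fin u → Set (asVariety (G (Fin.last n)))) (s : Fin u → Fin n),
      Set.range H = tracedFamily G →
      (∀ i, IsLeast {k : Fin n | trace (G (Fin.last n)) (G k.castSucc : Set X) = H i} (s i)) →
      StrictMono s →
      ∀ i : Fin u, IsWellConnectedBuildingSet (H '' Set.Iic i)) := by
  have : JacobsonSpace X := LocallyOfFiniteType.jacobsonSpace π
  have : IsLocallyNoetherian X := LocallyOfFiniteType.isLocallyNoetherian π
  have : CompactSpace X := QuasiCompact.compactSpace_of_compactSpace π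
  have : AlgebraicGeometry.IsNoetherian X := {}
  set Z := G (Fin.last n) with hZdef
  set 𝒢 : Set (Set X) := Set.range fun i => (G i : Set X) with h𝒢
  have hZ : (Z : Set X) ∈ 𝒢 := ⟨Fin.last n, rfl⟩
  have hmax : ∀ A ∈ 𝒢, (Z : Set X) ⊆ A → A = Z := by
    rintro _ ⟨i, rfl⟩ hi
    by_contra hne
    exact (Fin.le_last i).not_gt
      (hord _ _ (lt_of_le_of_ne hi fun h => hne (congrArg SetLike.coe h.symm)))
  have hcast : ∀ A ∈ 𝒢, A ≠ Z → ∃ k : Fin n, (G k.castSucc : Set X) = A := by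
    rintro _ ⟨i, rfl⟩ hi
    induction i using Fin.lastCases with
    | last => exact absurd rfl hi
    | cast k => exact ⟨k, rfl⟩
  have hcast' : ∀ k : Fin n, (G k.castSucc : Set X) ≠ Z := fun k hk =>
    (Fin.castSucc_lt_last k).ne (hinj (SetLike.coe_injective hk))
  have hfam : tracedFamily G = traces 𝒢 Z := by
    ext H
    constructor
    · rintro ⟨k, hk⟩
      exact ⟨_, ⟨k.castSucc, rfl⟩, hcast' k, hk⟩
    · rintro ⟨A, hA, hAZ, hH⟩
      obtain ⟨k, rfl⟩ := hcast A hA hAZ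
      exact ⟨k, hH⟩
  rw [hfam]
  have hwell := isWellConnectedBuildingSet_traces hG hZ hmax
  refine ⟨hwell, ?_, ?_⟩
  · intro H hH
    obtain ⟨A, hA, hAZ, rfl⟩ := eq_trace_of_mem_traces hG hZ hmax hH
    obtain ⟨k, rfl⟩ := hcast A hA hAZ
    exact ⟨k, rfl⟩
  · intro u H s hH hs hmono i
    have : AlgebraicGeometry.IsNoetherian (asVariety Z) := {
      LocallyOfFiniteType.isLocallyNoetherian (inclusion Z ≫ π),
      (inclusion Z).isClosedEmbedding.compactSpace with }
    have : JacobsonSpace (asVariety Z) := .of_isClosedEmbedding (inclusion Z).isClosedEmbedding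
    -- The listing of the traces is compatible with inclusion, so initial segments are closed
    -- downwards.
    have key : ∀ a b, H a ⊆ H b → a ≤ b := by
      intro a b hab
      have ha : trace Z (G (s a).castSucc : Set X) = H a := (hs a).1
      have hb : trace Z (G (s b).castSucc : Set X) = H b := (hs b).1
      have hHa : H a ∈ traces 𝒢 Z := hH ▸ ⟨a, rfl⟩
      have hconn : _root_.IsConnected ((G (s a).castSucc : Set X) ∩ Z) := by
        rw [← image_trace, ha]
        exact (hwell.isBuildingSet.connected _ hHa).image _ (inclusion Z).continuous.continuousOn
      have hsub : (G (s a).castSucc : Set X) ∩ Z ⊆ G (s b).castSucc := by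
        rw [← image_trace, ha]
        refine (Set.image_mono hab).trans ?_
        rw [← hb, image_trace]
        exact Set.inter_subset_left
      rw [← hmono.le_iff_le]
      rcases subset_or_exists_ssubset_of_inter_subset hG.isBuildingSet ⟨_, rfl⟩ ⟨_, rfl⟩ hZ
        (fun h => hcast' _ (hmax _ ⟨_, rfl⟩ h)) hconn hsub with h1 | ⟨K, hK, hKA, hKZ⟩
      · rcases (show G (s a).castSucc ≤ G (s b).castSucc from h1).eq_or_lt with h2 | h2
        · exact (Fin.castSucc_injective _ (hinj h2)).le
        · exact (Fin.castSucc_lt_castSucc_iff.1 (hord _ _ h2)).le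
      · exfalso
        have hKne : K ≠ Z := by
          rintro rfl
          exact hcast' (s a) (hmax _ ⟨_, rfl⟩ hKA.subset)
        obtain ⟨k, rfl⟩ := hcast K hK hKne
        have hk : s a ≤ k := (hs a).2 (by
          change trace Z _ = H a
          rw [← ha]
          apply (inclusion_injective Z).image_injective
          rw [image_trace, image_trace, hKZ])
        exact hk.not_gt (Fin.castSucc_lt_castSucc_iff.1 (hord _ _ hKA))
    refine hwell.mono ?_ ?_
    · rintro _ ⟨j, -, rfl⟩
      exact hH ▸ ⟨j, rfl⟩
    · rintro A hA _ ⟨j, hj, rfl⟩ hAj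
      obtain ⟨a, rfl⟩ := hH.symm.subset hA
      exact ⟨a, (key a j hAj).trans hj, rfl⟩
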